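/- Consider a chain of $n$ rigid links of lengths $l_i>0$ connected by spherical joints, with masses $m_i>0$ concentrated at the outboard ends of the links, attached to a cart of mass $m>0$ that moves in a horizontal plane and is acted on by a horizontal force $u\in\mathbb R^2$; gravity $g>0$ acts in the direction $e_3$. Let $C=[e_1,e_2]\in\mathbb R^{3\times2}$, let $\hat a\,b=a\times b$ be the hat map, and put $$M_{00}=m+\sum_{i=1}^n m_i,\qquad M_{0i}=M_{i0}^T=C^T\sum_{a=i}^n m_a l_i,\qquad M_{ij}=\Big(\sum_{a=\max\{i,j\}}^n m_a\Big)l_il_j .$$ With cart position $x\in\mathbb R^2$, link directions $q_i\in S^2$ and angular velocities $\omega_i\in\mathbb R^3$, $\omega_i\cdot q_i=0$, the equations of motion are $\dot q_i=\omega_i\times q_i$ and, for $i=1,\dots,n$, $$M_{00}\ddot x-\sum_{j=1}^n M_{0j}\hat q_j\dot\omega_j=\sum_{j=1}^n M_{0j}\|\omega_j\|^2q_j+u,$$ $$\hat q_iM_{i0}\ddot x+M_{ii}\dot\omega_i-\sum_{j\ne i}M_{ij}\hat q_i\hat q_j\dot\omega_j=\sum_{j\neq i}M_{ij}\|\omega_j\|^2\hat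 q_iq_j+\sum_{a=i}^n m_agl_i\,\hat q_ie_3 .$$ Let $s=(s_1,\dots,s_n)\in\{1,-1\}^n$, and consider the equilibrium $x=0$, $\dot x=0$, $q_i=s_ie_3$, $\omega_i=0$ of the uncontrolled system. The linearized equation at this equilibrium, in the variable $\mathbf x=[\delta x;C^T\xi_1;\dots;C^T\xi_n]\in\mathbb R^{2n+2}$ (where $\delta q_i=\xi_i\times s_ie_3$, $\xi_i\cdot e_3=0$), is $$\mathbf M\ddot{\mathbf x}+\mathbf G\mathbf x=\mathbf Bu,\qquad \mathbf M=\begin{bmatrix}M_{00}I_2&\mathbf M_{xq}\\ \mathbf M_{xq}^T&\mathbf M_{qq}\end{bmatrix},\quad \mathbf G=\begin{bmatrix}0&0\\0&\mathbf G_{qq}\end{bmatrix},\quad \mathbf B=\begin{bmatrix}I_2\\0\end{bmatrix},$$ where $\mathbf M_{xq}=[-s_1M_{01}\hat e_3C,\dots,-s_nM_{0n}\hat e_3C]$, the $(i,j)$ block of $\mathbf M_{qq}$ is $s_is_jM_{ij}I_2$, and $\mathbf G_{qq}$ is block diagonal with blocks $s_i\sum_{a=i}^n m_agl_iI_2$.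 Assume that this linear control system is controllable, i.e. any state $(\mathbf x,\dot{\mathbf x})$ can be steered to any other one in finite time. Then there exist gains $K_x,K_{\dot x},K_{q_i},K_{\omega_i}\in\mathbb R^{2\times2}$ $(i=1,\dots,n)$ such that, under the feedback $$u=-K_xx-K_{\dot x}\dot x-\sum_{i=1}^n\big\{K_{q_i}C^T(s_ie_3\times q_i)+K_{\omega_i}C^T\omega_i\big\},$$ the given equilibrium of the nonlinear closed-loop system on $\{(x,\dot x,q,\omega): q_i\in S^2,\ \omega_i\cdot q_i=0\}$ is locally asymptotically stable in the sense of Lyapunov. -/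

import Mathlib

open scoped Matrix Topology

namespace ChainPendulum

/-! ### Vectors in space -/

/-- The unit vector `e₃`, pointing in the direction of gravity. -/
def e3 : Fin 3 → ℝ := ![0, 0, 1]

/-- The matrix `C = [e₁, e₂]`, embedding the horizontal plane into space. -/
def C : Matrix (Fin 3) (Fin 2) ℝ := !![1, 0; 0, 1; 0, 0]

/-- The hat map: `hat x` is the skew-symmetric matrix of `y ↦ x × y`. -/
def hat (x : Fin 3 → ℝ) : Matrix (Fin 3) (Fin 3) ℝ :=
  !![0, -x 2, x 1; x 2, 0, -x 0; -x 1, x 0, 0]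

theorem hat_mulVec (x y : Fin 3 → ℝ) : hat x *ᵥ y = crossProduct x y := by
  ext i
  fin_cases i <;> simp [hat, cross_apply, Matrix.mulVec, dotProduct, Fin.sum_univ_three] <;> ring

/-! ### The mechanical system -/

/-- Physical parameters of a chain pendulum with `n` links on a cart: cart mass, link masses,
link lengths and gravitational acceleration. The links are numbered from the cart outwards. -/
structure Params (n : ℕ) where
  cartMass : ℝ
  mass : Fin n → ℝ
  length : Fin n → ℝ
  g : ℝ
  cartMass_pos : 0 < cartMass
  mass_pos : ∀ i, 0 < mass i
  length_pos : ∀ i, 0 < length i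
  g_pos : 0 < g

namespace Params

variable {n : ℕ} (P : Params n)

/-- `∑_{a = i}^n m_a`, the total mass carried by link `i`. -/
def outerMass (i : Fin n) : ℝ := ∑ a ∈ Finset.Ici i, P.mass a

/-- The scalar inertia `M₀₀`. -/
def M00 : ℝ := P.cartMass + ∑ i, P.mass i

/-- The `2 × 3` inertia matrix `M₀ᵢ`. -/
def M0 (i : Fin n) : Matrix (Fin 2) (Fin 3) ℝ := (P.outerMass i * P.length i) • Cᵀ

/-- The scalar inertia `Mᵢⱼ`. -/
def Mq (i j : Fin n) : ℝ := P.outerMass (max i j) * P.length i * P.length j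

end Params

/-- Tuples `(x, ẋ, q, ω)`: cart position, cart velocity, link directions, angular velocities. -/
abbrev State (n : ℕ) : Type :=
  (Fin 2 → ℝ) × (Fin 2 → ℝ) × (Fin n → Fin 3 → ℝ) × (Fin n → Fin 3 → ℝ)

/-- The phase space: `q i ∈ S²` and `ω i · q i = 0` for every link. -/
def phaseSpace (n : ℕ) : Set (State n) :=
  {z | ∀ i, z.2.2.1 i ⬝ᵥ z.2.2.1 i = 1 ∧ z.2.2.2 i ⬝ᵥ z.2.2.1 i = 0}

/-- The Euler-Lagrange equations of the chain pendulum on a cart, under the control force `u`,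
as a relation between a state `(x, ẋ, q, ω)` and its time derivative. -/
def EulerLagrange {n : ℕ} (P : Params n) (u : Fin 2 → ℝ) : State n → State n → Prop :=
  fun (_x, v, q, w) (dx, dv, dq, dw) =>
    dx = v ∧
    (∀ i, dq i = hat (w i) *ᵥ q i) ∧
    (P.M00 • dv - ∑ j, (P.M0 j * hat (q j)) *ᵥ dw j
      = ∑ j, (w j ⬝ᵥ w j) • (P.M0 j *ᵥ q j) + u) ∧
    (∀ i, (hat (q i) * (P.M0 i)ᵀ) *ᵥ dv + P.Mq i i • dw i
        - ∑ j ∈ Finset.univ.erase i, P.Mq i j • ((hat (q i) * hat (q j)) *ᵥ dw j)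
      = ∑ j ∈ Finset.univ.erase i, (P.Mq i j * (w j ⬝ᵥ w j)) • (hat (q i) *ᵥ q j)
        + (P.outerMass i * P.g * P.length i) • (hat (q i) *ᵥ e3))

/-- The equilibrium with `x = 0` and `q i = s i • e₃`. -/
def equilibrium {n : ℕ} (s : Fin n → ℝ) : State n := (0, 0, fun i => s i • e3, 0)

/-! ### The feedback -/

/-- The gains of the proportional-derivative feedback. -/
structure Gains (n : ℕ) where
  Kx : Matrix (Fin 2) (Fin 2) ℝ
  Kv : Matrix (Fin 2) (Fin 2) ℝ
  Kq : Fin n → Matrix (Fin 2) (Fin 2) ℝ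
  Kw : Fin n → Matrix (Fin 2) (Fin 2) ℝ

/-- The control force
`u = -K_x x - K_ẋ ẋ - ∑ᵢ (K_{qᵢ} Cᵀ (sᵢ e₃ × qᵢ) + K_{ωᵢ} Cᵀ ωᵢ)`. -/
def feedback {n : ℕ} (s : Fin n → ℝ) (K : Gains n) : State n → Fin 2 → ℝ :=
  fun (x, v, q, w) =>
    -(K.Kx *ᵥ x) - K.Kv *ᵥ v
      - ∑ i, (K.Kq i *ᵥ (Cᵀ *ᵥ (hat (s i • e3) *ᵥ q i)) + K.Kw i *ᵥ (Cᵀ *ᵥ w i))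

/-- The closed-loop equations: the Euler-Lagrange equations under the feedback force. -/
def ClosedLoop {n : ℕ} (P : Params n) (s : Fin n → ℝ) (K : Gains n) (z dz : State n) : Prop :=
  EulerLagrange P (feedback s K z) z dz

/-! ### The linearized equation -/

/-- Index set of `[δx; Cᵀ ξ₁; …; Cᵀ ξₙ] ∈ ℝ^{2n+2}`. -/
abbrev LinIdx (n : ℕ) : Type := Fin 2 ⊕ (Fin n × Fin 2)

/-- The block `M_xq = [-s₁ M₀₁ ê₃ C, …, -sₙ M₀ₙ ê₃ C]`. -/
def linMxq {n : ℕ} (P : Params n) (s : Fin n → ℝ) : Matrix (Fin 2) (Fin n × Fin 2) ℝ :=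
  Matrix.of fun k jl => (-s jl.1 • (P.M0 jl.1 * hat e3 * C)) k jl.2

/-- The block `M_qq`, whose `(i, j)` block is `sᵢ sⱼ Mᵢⱼ I₂`. -/
def linMqq {n : ℕ} (P : Params n) (s : Fin n → ℝ) :
    Matrix (Fin n × Fin 2) (Fin n × Fin 2) ℝ :=
  Matrix.of fun ik jl =>
    ((s ik.1 * s jl.1 * P.Mq ik.1 jl.1) • (1 : Matrix (Fin 2) (Fin 2) ℝ)) ik.2 jl.2

/-- The block `G_qq`, block diagonal with blocks `sᵢ (∑_{a ≥ i} m_a) g lᵢ I₂`. -/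
def linGqq {n : ℕ} (P : Params n) (s : Fin n → ℝ) :
    Matrix (Fin n × Fin 2) (Fin n × Fin 2) ℝ :=
  Matrix.diagonal fun ik => s ik.1 * (P.outerMass ik.1 * P.g * P.length ik.1)

/-- The inertia matrix of the linearized equation. -/
def linM {n : ℕ} (P : Params n) (s : Fin n → ℝ) : Matrix (LinIdx n) (LinIdx n) ℝ :=
  Matrix.fromBlocks (P.M00 • 1) (linMxq P s) (linMxq P s)ᵀ (linMqq P s)

/-- The stiffness matrix of the linearized equation. -/
def linG {n : ℕ} (P : Params n) (s : Fin n → ℝ) : Matrix (LinIdx n) (LinIdx n) ℝ :=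
  Matrix.fromBlocks 0 0 0 (linGqq P s)

/-- The input matrix `[I₂; 0]` of the linearized equation. -/
def linB (n : ℕ) : Matrix (LinIdx n) (Fin 2) ℝ := Matrix.fromRows 1 0

/-- Controllability of the second-order linear control system `M ẍ + G x = B u`: any state
`(x, ẋ)` can be steered to any other one in some finite time by a continuous control. -/
def IsControllable {ι κ : Type*} [Fintype ι] [Fintype κ]
    (M G : Matrix ι ι ℝ) (B : Matrix ι κ ℝ) : Prop :=
  ∀ x₀ v₀ x₁ v₁ : ι → ℝ, ∃ T : ℝ, 0 < T ∧ ∃ u : ℝ → κ → ℝ, ContinuousOn u (Set.Icc 0 T) ∧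
    ∃ x v : ℝ → ι → ℝ,
      (∀ t ∈ Set.Icc 0 T, HasDerivWithinAt x (v t) (Set.Icc 0 T) t ∧
        ∃ a, HasDerivWithinAt v a (Set.Icc 0 T) t ∧ M *ᵥ a + G *ᵥ x t = B *ᵥ u t) ∧
      x 0 = x₀ ∧ v 0 = v₀ ∧ x T = x₁ ∧ v T = v₁

/-! ### Stability -/

section Stability

variable {E : Type*} [NormedAddCommGroup E] [NormedSpace ℝ E]

/-- `γ` is on the time interval `I` a curve in `Φ` that solves the (implicit) first-order
differential equation `F γ γ'`. -/
def IsSolutionOn (Φ : Set E) (F : E → E → Prop) (I : Set ℝ) (γ : ℝ → E) : Prop :=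
  ∀ t ∈ I, γ t ∈ Φ ∧ ∃ d, HasDerivWithinAt γ d I t ∧ F (γ t) d

/-- Local asymptotic stability (in the sense of Lyapunov) of the point `e` for the differential
equation `F` on `Φ`: `e` is an equilibrium; solutions starting close to `e` exist for all
future times and every solution starting there stays close to `e` as long as it is defined;
all solutions starting in some neighbourhood of `e` converge to `e`. -/
def IsLocallyAsymptoticallyStable (Φ : Set E) (F : E → E → Prop) (e : E) : Prop :=
  (e ∈ Φ ∧ F e 0) ∧
  (∀ ε > 0, ∃ δ > 0, ∀ z ∈ Φ, dist z e < δ →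
    (∃ γ : ℝ → E, γ 0 = z ∧ IsSolutionOn Φ F (Set.Ici 0) γ) ∧
    ∀ T > 0, ∀ γ : ℝ → E, γ 0 = z → IsSolutionOn Φ F (Set.Ico 0 T) γ →
      ∀ t ∈ Set.Ico 0 T, dist (γ t) e < ε) ∧
  (∃ δ > 0, ∀ z ∈ Φ, dist z e < δ →
    ∀ γ : ℝ → E, γ 0 = z → IsSolutionOn Φ F (Set.Ici 0) γ →
      Filter.Tendsto γ Filter.atTop (𝓝 e))

end Stability

end ChainPendulum

/-!
The linearized equation is put in first-order form `y' = A y + B u` and stabilized, and the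
resulting quadratic Lyapunov function is pulled back to the nonlinear system.

*Linear part.* Controllability forbids nonzero `Aᵀ`-invariant subspaces of `ker Bᵀ`
(`IsControllable.eq_bot_of_invariant`). For `λ` large the Lyapunov equation
`(A + λ) W + W (A + λ)ᵀ = B Bᵀ` has a unique solution `W`; it is positive semidefinite, and its
kernel is such a subspace, so it is positive definite. With `K = ½ Bᵀ W⁻¹` the form
`V(y) = y · W⁻¹ y` satisfies `V' = -2 λ V` exactly along `y' = (A - B K) y`
(`exists_gain_lyapunov`).

*Mechanics.* On the phase space the equations of motion are linear in the accelerations, with an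
operator that is injective because the kinetic energy is positive definite
(`inertia_injective`). So they are equivalent to `z' = f z` for a vector field `f` on the ambient
space of all `(x, ẋ, q, ω)`, which is of class `C¹` near the equilibrium and leaves the phase
space invariant (`mem_phaseSpace_of_solution`). The coordinates `L z = (𝐱, 𝐱̇)` of the linearized
equation satisfy `L ∘ f'(e) = (A - B K) ∘ L` on the whole ambient space (`linCoord_fderiv`), and
on the phase space near the equilibrium `e` they bound the distance to `e`
(`dist_equilibrium_le`).

*Stability.* Hence `V ∘ L` is a strict Lyapunov function on the phase space near `e`
(`exists_isStrictLyapunov`). Its sublevel sets trap solutions, which therefore exist for all times,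
remain close to `e` and converge to it (`IsStrictLyapunov.isLocallyAsymptoticallyStable`).
-/

namespace ChainPendulum

/-! ### Controllability and linear stabilization -/

section Linear

variable {ι κ : Type*} [Fintype ι] [Fintype κ] [DecidableEq ι]

theorem exists_pos_shift (A : Matrix ι ι ℝ) :
    ∃ l : ℝ, 0 < l ∧ ∀ y : ι → ℝ, y ≠ 0 → 0 < y ⬝ᵥ ((A + l • 1) *ᵥ y) := by
  set c := ∑ i, ∑ j, |A i j| with hc
  have hc0 : 0 ≤ c := Finset.sum_nonneg fun i _ => Finset.sum_nonneg fun j _ => abs_nonneg _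
  refine ⟨c + 1, by linarith, fun y hy => ?_⟩
  have hyy : 0 < y ⬝ᵥ y := by
    have h := Matrix.dotProduct_star_self_pos_iff.2 hy
    simpa using h
  have hsq : ∀ i, y i * y i ≤ y ⬝ᵥ y := fun i =>
    Finset.single_le_sum (f := fun i => y i * y i) (fun j _ => mul_self_nonneg _)
      (Finset.mem_univ i)
  have h1 : -(c * (y ⬝ᵥ y)) ≤ y ⬝ᵥ (A *ᵥ y) := by
    generalize y ⬝ᵥ y = d at hsq
    simp only [hc, Finset.sum_mul, ← Finset.sum_neg_distrib, dotProduct, Matrix.mulVec,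
      Finset.mul_sum]
    refine Finset.sum_le_sum fun i _ => Finset.sum_le_sum fun j _ => ?_
    have h2 : |y i * y j| ≤ d :=
      abs_le.2 ⟨by nlinarith [hsq i, hsq j, sq_nonneg (y i + y j)],
        by nlinarith [hsq i, hsq j, sq_nonneg (y i - y j)]⟩
    have h3 : |y i * (A i j * y j)| = |A i j| * |y i * y j| := by
      rw [← abs_mul]; congr 1; ring
    have h4 := mul_le_mul_of_nonneg_left h2 (abs_nonneg (A i j))
    have h5 := neg_abs_le (y i * (A i j * y j))
    rw [h3] at h5
    linarith
  rw [Matrix.add_mulVec, dotProduct_add, Matrix.smul_mulVec, Matrix.one_mulVec, dotProduct_smul,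
    smul_eq_mul]
  nlinarith

/-- The Lyapunov equation `X W + W Xᵀ = R` is uniquely solvable when the symmetric part of `X` is
positive definite: pairing the homogeneous equation with `W` in the trace form gives
`tr (Wᵀ X W) + tr (W Xᵀ Wᵀ) = 0`, a sum of values of the quadratic form of `X` at the columns and
the rows of `W`. -/
theorem lyapunov_bijective {X : Matrix ι ι ℝ} (hX : ∀ y : ι → ℝ, y ≠ 0 → 0 < y ⬝ᵥ (X *ᵥ y)) :
    Function.Bijective fun W : Matrix ι ι ℝ => X * W + W * Xᵀ := by
  let f : Matrix ι ι ℝ →ₗ[ℝ] Matrix ι ι ℝ :=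
    LinearMap.mulLeft ℝ X + LinearMap.mulRight ℝ Xᵀ
  have hX' : ∀ y : ι → ℝ, 0 ≤ y ⬝ᵥ (X *ᵥ y) := fun y => by
    by_cases hy : y = 0
    · simp [hy]
    · exact (hX y hy).le
  have hinj : Function.Injective f := by
    rw [injective_iff_map_eq_zero]
    intro W hW
    have hW' : X * W + W * Xᵀ = 0 := hW
    have h1 : (Wᵀ * (X * W)).trace + (W * (X * Wᵀ)).trace = 0 := by
      have : (W * (X * Wᵀ)).trace = (Wᵀ * (W * Xᵀ)).trace := by
        rw [← Matrix.trace_transpose, Matrix.transpose_mul, Matrix.transpose_mul,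
          Matrix.transpose_transpose, Matrix.mul_assoc, Matrix.trace_mul_comm Wᵀ, Matrix.mul_assoc]
      rw [this, ← Matrix.trace_add, ← Matrix.mul_add, hW', Matrix.mul_zero, Matrix.trace_zero]
    have hcol : ∀ Z : Matrix ι ι ℝ, (Zᵀ * (X * Z)).trace = ∑ j, Z.col j ⬝ᵥ (X *ᵥ Z.col j) := by
      intro Z
      simp only [Matrix.trace, Matrix.diag, Matrix.mul_apply, dotProduct, Matrix.mulVec,
        Matrix.transpose_apply, Matrix.col_apply]
    have h2 := hcol Wᵀ
    rw [Matrix.transpose_transpose] at h2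
    have h3 : 0 ≤ (W * (X * Wᵀ)).trace := by
      rw [h2]; exact Finset.sum_nonneg fun j _ => hX' _
    have h4 : ∑ j, W.col j ⬝ᵥ (X *ᵥ W.col j) = 0 := by
      refine le_antisymm ?_ (Finset.sum_nonneg fun j _ => hX' _)
      rw [← hcol]; linarith
    rw [Finset.sum_eq_zero_iff_of_nonneg fun j _ => hX' _] at h4
    ext i j
    by_contra hne
    have : W.col j ≠ 0 := fun h => hne (congrFun h i)
    exact (hX _ this).ne' (h4 j (Finset.mem_univ j))
  exact ⟨hinj, LinearMap.surjective_of_injective hinj⟩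

/-- If no nonzero `Aᵀ`-invariant subspace lies in the kernel of `Bᵀ`, then some feedback makes the
closed loop exponentially stable, with an explicit quadratic Lyapunov function. For `λ` so large
that `A + λ` has positive definite symmetric part, the solution `W` of
`(A + λ) W + W (A + λ)ᵀ = B Bᵀ` is positive definite, and `K = ½ Bᵀ W⁻¹`, `Q = W⁻¹` work. -/
theorem exists_gain_lyapunov (A : Matrix ι ι ℝ) (B : Matrix ι κ ℝ)
    (h : ∀ N : Submodule ℝ (ι → ℝ), (∀ y ∈ N, Aᵀ *ᵥ y ∈ N) → (∀ y ∈ N, Bᵀ *ᵥ y = 0) → N = ⊥) :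
    ∃ (K : Matrix κ ι ℝ) (Q : Matrix ι ι ℝ) (μ : ℝ), 0 < μ ∧ Q.PosDef ∧
      Q * (A - B * K) + (A - B * K)ᵀ * Q = -μ • Q := by
  obtain ⟨l, hl, hX⟩ := exists_pos_shift A
  set X := A + l • (1 : Matrix ι ι ℝ) with hXdef
  obtain ⟨W, hW⟩ := (lyapunov_bijective hX).2 (B * Bᵀ)
  replace hW : X * W + W * Xᵀ = B * Bᵀ := hW
  have hsymm : Wᵀ = W := by
    apply (lyapunov_bijective hX).1
    change X * Wᵀ + Wᵀ * Xᵀ = X * W + W * Xᵀ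
    rw [hW]
    conv_rhs => rw [← Matrix.transpose_transpose B, ← Matrix.transpose_mul,
      Matrix.transpose_transpose, ← hW]
    simp [Matrix.transpose_mul, add_comm]
  have hform : ∀ y : ι → ℝ, (Bᵀ *ᵥ y) ⬝ᵥ (Bᵀ *ᵥ y) = 2 * ((W *ᵥ y) ⬝ᵥ (Xᵀ *ᵥ y)) := by
    intro y
    have h1 : (Bᵀ *ᵥ y) ⬝ᵥ (Bᵀ *ᵥ y) = y ⬝ᵥ ((B * Bᵀ) *ᵥ y) := by
      rw [← Matrix.mulVec_mulVec, Matrix.dotProduct_mulVec y, ← Matrix.mulVec_transpose]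
    rw [h1, ← hW, Matrix.add_mulVec, dotProduct_add, ← Matrix.mulVec_mulVec,
      ← Matrix.mulVec_mulVec, Matrix.dotProduct_mulVec y X, Matrix.dotProduct_mulVec y W,
      ← Matrix.mulVec_transpose, ← Matrix.mulVec_transpose, hsymm,
      dotProduct_comm (Xᵀ *ᵥ y)]
    ring
  have hker : LinearMap.ker W.mulVecLin = ⊥ := by
    have hB : ∀ y ∈ LinearMap.ker W.mulVecLin, Bᵀ *ᵥ y = 0 := by
      intro y hy
      have hy' : W *ᵥ y = 0 := hy
      have := hform y
      rw [hy', zero_dotProduct, mul_zero] at this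
      exact dotProduct_self_eq_zero.1 this
    refine h _ (fun y hy => ?_) hB
    have hy' : W *ᵥ y = 0 := hy
    have h1 : (X * W + W * Xᵀ) *ᵥ y = 0 := by
      rw [hW, ← Matrix.mulVec_mulVec, hB y hy, Matrix.mulVec_zero]
    rw [Matrix.add_mulVec, ← Matrix.mulVec_mulVec, hy', Matrix.mulVec_zero, zero_add,
      ← Matrix.mulVec_mulVec, hXdef, Matrix.transpose_add, Matrix.transpose_smul,
      Matrix.transpose_one, Matrix.add_mulVec, Matrix.mulVec_add, Matrix.smul_mulVec,
      Matrix.one_mulVec, Matrix.mulVec_smul, hy', smul_zero, add_zero] at h1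
    exact h1
  have hherm : W.IsHermitian := by
    rw [Matrix.IsHermitian, Matrix.conjTranspose_eq_transpose_of_trivial, hsymm]
  have hpos : W.PosDef := by
    rw [hherm.posDef_iff_eigenvalues_pos]
    intro i
    set y : ι → ℝ := ⇑(hherm.eigenvectorBasis i) with hy
    have hWy : W *ᵥ y = hherm.eigenvalues i • y := hherm.mulVec_eigenvectorBasis i
    have hy0 : y ≠ 0 := by
      intro h0
      apply hherm.eigenvectorBasis.orthonormal.ne_zero i
      ext k
      exact congrFun h0 k
    have h1 := hform y
    rw [hWy, smul_dotProduct, smul_eq_mul, Matrix.mulVec_transpose X, dotProduct_comm y,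
      ← Matrix.dotProduct_mulVec] at h1
    have h2 := hX y hy0
    have h3 : 0 ≤ (Bᵀ *ᵥ y) ⬝ᵥ (Bᵀ *ᵥ y) := by
      exact Finset.sum_nonneg fun j _ => mul_self_nonneg _
    have h4 : hherm.eigenvalues i ≠ 0 := by
      intro h0
      rw [h0, zero_smul] at hWy
      have : y ∈ LinearMap.ker W.mulVecLin := hWy
      rw [hker] at this
      exact hy0 this
    have h5 : 0 ≤ hherm.eigenvalues i := by
      rw [h1] at h3
      by_contra hneg
      push Not at hneg
      nlinarith
    exact lt_of_le_of_ne h5 h4.symm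
  have hunit : IsUnit W.det := hpos.det_pos.ne'.isUnit
  have hW1 : W * W⁻¹ = 1 := Matrix.mul_nonsing_inv _ hunit
  have hW2 : W⁻¹ * W = 1 := Matrix.nonsing_inv_mul _ hunit
  have hQt : (W⁻¹)ᵀ = W⁻¹ := by rw [Matrix.transpose_nonsing_inv, hsymm]
  refine ⟨(2⁻¹ : ℝ) • (Bᵀ * W⁻¹), W⁻¹, 2 * l, by linarith, hpos.inv, ?_⟩
  -- Conjugating `A W + W Aᵀ = B Bᵀ - 2 λ W` by `W⁻¹` gives the equation for `Q = W⁻¹`.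
  have h1 : W⁻¹ * A + Aᵀ * W⁻¹ = W⁻¹ * (B * Bᵀ) * W⁻¹ - (2 * l) • W⁻¹ := by
    have : W⁻¹ * (B * Bᵀ) * W⁻¹ = W⁻¹ * A + Aᵀ * W⁻¹ + (2 * l) • W⁻¹ := by
      rw [← hW, hXdef]
      simp only [Matrix.transpose_add, Matrix.transpose_smul, Matrix.transpose_one,
        Matrix.add_mul, Matrix.mul_add, Matrix.smul_mul, Matrix.mul_smul, Matrix.one_mul,
        Matrix.mul_one]
      rw [show W⁻¹ * (A * W) * W⁻¹ = W⁻¹ * A * (W * W⁻¹) by simp only [Matrix.mul_assoc],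
        show W⁻¹ * (W * Aᵀ) * W⁻¹ = (W⁻¹ * W) * (Aᵀ * W⁻¹) by simp only [Matrix.mul_assoc],
        hW1, hW2, Matrix.mul_one, Matrix.one_mul, Matrix.one_mul, two_mul, add_smul]
      abel
    rw [this]; abel
  simp only [Matrix.mul_sub, Matrix.sub_mul, Matrix.transpose_sub, Matrix.transpose_mul,
    Matrix.transpose_smul, Matrix.mul_smul, Matrix.smul_mul, Matrix.transpose_transpose, hQt,
    Matrix.mul_assoc] at h1 ⊢
  rw [show ∀ a b c : Matrix ι ι ℝ, a - (2⁻¹ : ℝ) • c + (b - (2⁻¹ : ℝ) • c) = a + b - c by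
    intro a b c
    rw [sub_add_sub_comm, ← add_smul]; norm_num, h1]
  rw [neg_smul]; abel

/-- Costates in an `Aᵀ`-invariant subspace `N` of `ker Bᵀ` annihilate every state that can be
reached from rest. For a matrix `P` projecting onto `N`, the component `Pᵀ z` of a trajectory of
`z' = A z + B u` obeys the autonomous equation `(Pᵀ z)' = (Pᵀ A) (Pᵀ z)`, so it remains zero. -/
theorem dotProduct_eq_zero_of_trajectory {A : Matrix ι ι ℝ} {B : Matrix ι κ ℝ}
    {N : Submodule ℝ (ι → ℝ)} (hA : ∀ y ∈ N, Aᵀ *ᵥ y ∈ N) (hB : ∀ y ∈ N, Bᵀ *ᵥ y = 0)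
    {T : ℝ} (hT : 0 ≤ T) {u : ℝ → κ → ℝ} {z : ℝ → ι → ℝ} (h0 : z 0 = 0)
    (hz : ∀ t ∈ Set.Icc 0 T, HasDerivWithinAt z (A *ᵥ z t + B *ᵥ u t) (Set.Icc 0 T) t) :
    ∀ y ∈ N, y ⬝ᵥ z T = 0 := by
  obtain ⟨g, hg⟩ := LinearMap.exists_leftInverse_of_injective N.subtype N.ker_subtype
  set p : (ι → ℝ) →ₗ[ℝ] (ι → ℝ) := N.subtype ∘ₗ g with hp
  have hpN : ∀ y, p y ∈ N := fun y => (g y).2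
  have hpid : ∀ y ∈ N, p y = y := fun y hy =>
    congrArg Subtype.val (LinearMap.congr_fun hg ⟨y, hy⟩)
  set P := LinearMap.toMatrix' p with hP
  have hPm : ∀ y, P *ᵥ y = p y := fun y => LinearMap.toMatrix'_mulVec p y
  have hPA : Pᵀ * A * Pᵀ = Pᵀ * A := by
    have : P * (Aᵀ * P) = Aᵀ * P := by
      apply Matrix.ext_of_mulVec_single
      intro i
      rw [← Matrix.mulVec_mulVec, ← Matrix.mulVec_mulVec, hPm, hPm]
      exact hpid _ (hA _ (hpN _))
    have := congrArg Matrix.transpose this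
    simpa [Matrix.transpose_mul] using this
  have hPB : Pᵀ * B = 0 := by
    have : Bᵀ * P = 0 := by
      apply Matrix.ext_of_mulVec_single
      intro i
      rw [← Matrix.mulVec_mulVec, hPm, hB _ (hpN _), Matrix.zero_mulVec]
    have := congrArg Matrix.transpose this
    simpa [Matrix.transpose_mul] using this
  let L : (ι → ℝ) →L[ℝ] (ι → ℝ) := LinearMap.toContinuousLinearMap (Matrix.mulVecLin Pᵀ)
  let L' : (ι → ℝ) →L[ℝ] (ι → ℝ) := LinearMap.toContinuousLinearMap (Matrix.mulVecLin (Pᵀ * A))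
  have hL : ∀ y, L y = Pᵀ *ᵥ y := fun _ => rfl
  have hw : ∀ t ∈ Set.Icc 0 T,
      HasDerivWithinAt (fun t => L (z t)) (L' (L (z t))) (Set.Icc 0 T) t := by
    intro t ht
    have h1 := L.hasFDerivAt.comp_hasDerivWithinAt t (hz t ht)
    have h2 : L (A *ᵥ z t + B *ᵥ u t) = L' (L (z t)) := by
      change Pᵀ *ᵥ _ = (Pᵀ * A) *ᵥ (Pᵀ *ᵥ _)
      rw [Matrix.mulVec_mulVec, hPA, Matrix.mulVec_add, Matrix.mulVec_mulVec,
        Matrix.mulVec_mulVec, hPB, Matrix.zero_mulVec, add_zero]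
    rwa [h2] at h1
  have hzero := eq_zero_of_abs_deriv_le_mul_abs_self_of_eq_zero_right (K := ‖L'‖)
    (fun t ht => (hw t ht).continuousWithinAt)
    (fun t ht => (hw t ⟨ht.1, ht.2.le⟩).mono_of_mem_nhdsWithin
      (Icc_mem_nhdsGE_of_mem ht)) (by rw [h0, map_zero]) (fun t _ => L'.le_opNorm _)
    T ⟨hT, le_rfl⟩
  intro y hy
  rw [← hpid y hy, ← hPm, dotProduct_comm, Matrix.dotProduct_mulVec, ← Matrix.mulVec_transpose,
    ← hL, hzero, zero_dotProduct]

/-- The first-order form of a controllable system `M ẍ + G x = B u` satisfies the Kalman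
condition: an element `y` of an invariant subspace of costates that the input does not see is
orthogonal to every state reachable from rest, hence to itself. -/
theorem IsControllable.eq_bot_of_invariant {M G : Matrix ι ι ℝ} {B : Matrix ι κ ℝ}
    (h : IsControllable M G B) (hM : IsUnit M.det) (N : Submodule ℝ (ι ⊕ ι → ℝ))
    (hA : ∀ y ∈ N, (Matrix.fromBlocks 0 1 (-(M⁻¹ * G)) 0)ᵀ *ᵥ y ∈ N)
    (hB : ∀ y ∈ N, (Matrix.fromRows (0 : Matrix ι κ ℝ) (M⁻¹ * B))ᵀ *ᵥ y = 0) : N = ⊥ := by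
  rw [eq_bot_iff]
  intro y hy
  obtain ⟨T, hT, u, -, x, v, hxv, hx0, hv0, hxT, hvT⟩ := h 0 0 (y ∘ Sum.inl) (y ∘ Sum.inr)
  have hdot := dotProduct_eq_zero_of_trajectory hA hB hT.le (u := u)
    (z := fun t => Sum.elim (x t) (v t)) (by simp [hx0, hv0]) ?_ y hy
  · rw [hxT, hvT, Sum.elim_comp_inl_inr] at hdot
    exact (Submodule.mem_bot ℝ).2 (dotProduct_self_eq_zero.1 hdot)
  · intro t ht
    obtain ⟨h1, a, h2, h3⟩ := hxv t ht
    have ha : a = -(M⁻¹ * G) *ᵥ x t + (M⁻¹ * B) *ᵥ u t := by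
      have : M⁻¹ *ᵥ (M *ᵥ a) = M⁻¹ *ᵥ (B *ᵥ u t - G *ᵥ x t) := by
        rw [← h3, add_sub_cancel_right]
      rw [Matrix.mulVec_mulVec, Matrix.nonsing_inv_mul _ hM, Matrix.one_mulVec,
        Matrix.mulVec_sub, Matrix.mulVec_mulVec, Matrix.mulVec_mulVec] at this
      rw [this, Matrix.neg_mulVec]; abel
    rw [hasDerivWithinAt_pi] at h1 h2 ⊢
    rw [Matrix.fromBlocks_mulVec, Matrix.fromRows_mulVec]
    rintro (i | i)
    · simpa using h1 i
    · have := h2 i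
      rw [ha] at this
      simpa using this

end Linear

/-! ### Lyapunov's direct and indirect methods on an invariant set -/

section Lyapunov

variable {E : Type*} [NormedAddCommGroup E] [NormedSpace ℝ E]

/-- Solutions of a uniform duration `h` that do not leave `S` concatenate to global ones. -/
theorem exists_glued_solution {f : E → E} {S : Set E} {h : ℝ} (hh : 0 < h)
    (hloc : ∀ z ∈ S, ∃ α : ℝ → E, α 0 = z ∧
      ∀ t ∈ Set.Icc 0 h, α t ∈ S ∧ HasDerivWithinAt α (f (α t)) (Set.Icc 0 h) t)
    {z : E} (hz : z ∈ S) :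
    ∃ γ : ℝ → E, γ 0 = z ∧
      ∀ t ∈ Set.Ici (0 : ℝ), γ t ∈ S ∧ HasDerivWithinAt γ (f (γ t)) (Set.Ici 0) t := by
  choose! α hα0 hα using hloc
  let w : ℕ → E := fun k => Nat.rec z (fun _ x => α x h) k
  have hw1 : ∀ k, w (k + 1) = α (w k) h := fun _ => rfl
  have hwS : ∀ k, w k ∈ S := by
    intro k
    induction k with
    | zero => exact hz
    | succ k ih => exact (hα _ ih h ⟨hh.le, le_rfl⟩).1
  let γ : ℝ → E := fun t => α (w ⌊t / h⌋₊) (t - ⌊t / h⌋₊ * h)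
  have hγ : ∀ (k : ℕ) (t : ℝ), t ∈ Set.Icc (k * h) (k * h + h) → γ t = α (w k) (t - k * h) := by
    intro k t ht
    rcases ht.2.eq_or_lt with h1 | h1
    · have hfl : ⌊t / h⌋₊ = k + 1 := by
        rw [h1, show (k * h + h) / h = ((k + 1 : ℕ) : ℝ) by field_simp; push_cast; ring,
          Nat.floor_natCast]
      simp only [γ, hfl]
      rw [hw1, h1]
      push_cast
      rw [show k * h + h - (k + 1) * h = 0 by ring, add_sub_cancel_left]
      exact hα0 _ (hw1 k ▸ hwS (k + 1))
    · have hfl : ⌊t / h⌋₊ = k := by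
        rw [Nat.floor_eq_iff (div_nonneg (le_trans (by positivity) ht.1) hh.le)]
        exact ⟨(le_div_iff₀ hh).2 ht.1, (div_lt_iff₀ hh).2 (by linarith)⟩
      simp only [γ, hfl]
  have hseg : ∀ (k : ℕ) (t : ℝ), t ∈ Set.Icc (k * h) (k * h + h) →
      γ t ∈ S ∧ HasDerivWithinAt γ (f (γ t)) (Set.Icc (k * h) (k * h + h)) t := by
    intro k t ht
    have ht' : t - k * h ∈ Set.Icc 0 h := ⟨by linarith [ht.1], by linarith [ht.2]⟩
    obtain ⟨h1, h2⟩ := hα _ (hwS k) _ ht'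
    rw [hγ k t ht]
    refine ⟨h1, ?_⟩
    have h3 : HasDerivWithinAt (fun t : ℝ => t - k * h) 1 (Set.Icc (k * h) (k * h + h)) t :=
      ((hasDerivAt_id t).sub_const _).hasDerivWithinAt
    have hmaps : Set.MapsTo (fun t : ℝ => t - k * h) (Set.Icc (k * h) (k * h + h))
        (Set.Icc 0 h) := fun x hx => ⟨by linarith [hx.1], by linarith [hx.2]⟩
    have h4 := h2.scomp t h3 hmaps
    rw [one_smul] at h4
    exact h4.congr (fun x hx => hγ k x hx) (hγ k t ht)
  refine ⟨γ, ?_, fun t ht => ?_⟩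
  · rw [hγ 0 0 ⟨by simp, by simpa using hh.le⟩]
    rw [Nat.cast_zero, zero_mul, sub_zero]
    exact hα0 _ (hwS 0)
  · have ht0 : 0 ≤ t := ht
    have hk1 : (⌊t / h⌋₊ : ℝ) * h ≤ t := (le_div_iff₀ hh).1 (Nat.floor_le (by positivity))
    have hk2 : t < ⌊t / h⌋₊ * h + h := by
      have := (div_lt_iff₀ hh).1 (Nat.lt_floor_add_one (t / h)); linarith
    obtain ⟨h1, h2⟩ := hseg _ t ⟨hk1, hk2.le⟩
    refine ⟨h1, ?_⟩
    rcases hk1.eq_or_lt with heq | hlt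
    · -- At a junction time the two one-sided derivatives agree.
      rcases Nat.eq_zero_or_pos ⌊t / h⌋₊ with h0 | hpos
      · have ht' : t = 0 := by rw [h0] at heq; simpa using heq.symm
        refine h2.mono_of_mem_nhdsWithin ?_
        rw [h0, ht']
        simpa using Icc_mem_nhdsGE hh
      · obtain ⟨k, hk⟩ := Nat.exists_eq_succ_of_ne_zero hpos.ne'
        rw [hk] at heq hk2 h2
        push_cast [Nat.succ_eq_add_one] at heq hk2 h2
        have hle : (k : ℝ) * h + h = t := by linarith
        have h3 := (hseg k t ⟨by linarith, by linarith⟩).2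
        refine (h3.union h2).mono_of_mem_nhdsWithin (mem_nhdsWithin_of_mem_nhds ?_)
        refine Filter.mem_of_superset (Ioo_mem_nhds (a := k * h) (b := (k + 1) * h + h)
          (by linarith) (by linarith)) fun x hx => ?_
        rcases le_total x t with hxt | hxt
        · exact Or.inl ⟨hx.1.le, by linarith⟩
        · exact Or.inr ⟨by linarith, hx.2.le⟩
    · exact h2.mono_of_mem_nhdsWithin (mem_nhdsWithin_of_mem_nhds (Icc_mem_nhds hlt hk2))

/-- The data of a strict Lyapunov function for the vector field `f` on `Φ`, within distance `r`
of `e`: it dominates the squared distance to `e` and decays exponentially along `f`. -/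
structure IsStrictLyapunov (Φ : Set E) (f : E → E) (e : E) (V : E → ℝ) (r c μ : ℝ) : Prop where
  r_pos : 0 < r
  c_pos : 0 < c
  μ_pos : 0 < μ
  apply_self : V e = 0
  differentiable : Differentiable ℝ V
  lower : ∀ z ∈ Φ, dist z e < r → c * dist z e ^ 2 ≤ V z
  decay : ∀ z ∈ Φ, dist z e < r → fderiv ℝ V z (f z) ≤ -μ * V z

namespace IsStrictLyapunov

variable {Φ : Set E} {f : E → E} {e : E} {V : E → ℝ} {r c μ : ℝ}

theorem exp_bound (hV : IsStrictLyapunov Φ f e V r c μ) {T : ℝ} {γ : ℝ → E}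
    (hγΦ : ∀ t ∈ Set.Icc 0 T, γ t ∈ Φ)
    (hγ : ∀ t ∈ Set.Icc 0 T, HasDerivWithinAt γ (f (γ t)) (Set.Icc 0 T) t)
    (hr : ∀ t ∈ Set.Ico 0 T, dist (γ t) e < r) {t : ℝ} (ht : t ∈ Set.Icc 0 T) :
    V (γ t) ≤ Real.exp (-μ * t) * V (γ 0) := by
  have hder : ∀ t ∈ Set.Icc 0 T, HasDerivWithinAt (fun t => Real.exp (μ * t) * V (γ t))
      (Real.exp (μ * t) * μ * V (γ t) + Real.exp (μ * t) * fderiv ℝ V (γ t) (f (γ t)))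
      (Set.Icc 0 T) t := by
    intro t ht
    have h1 : HasDerivAt (fun t => Real.exp (μ * t)) (Real.exp (μ * t) * μ) t := by
      simpa using ((hasDerivAt_id t).const_mul μ).exp
    exact h1.hasDerivWithinAt.mul
      ((hV.differentiable (γ t)).hasFDerivAt.comp_hasDerivWithinAt t (hγ t ht))
  have hanti : AntitoneOn (fun t => Real.exp (μ * t) * V (γ t)) (Set.Icc 0 T) := by
    refine antitoneOn_of_hasDerivWithinAt_nonpos (convex_Icc 0 T)
      (fun t ht => (hder t ht).continuousWithinAt)
      (fun t ht => (hder t (interior_subset ht)).mono interior_subset) fun t ht => ?_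
    rw [interior_Icc] at ht
    have h1 := hV.decay _ (hγΦ t (Set.Ioo_subset_Icc_self ht)) (hr t (Set.Ioo_subset_Ico_self ht))
    nlinarith [Real.exp_pos (μ * t)]
  have h1 := hanti ⟨le_rfl, ht.1.trans ht.2⟩ ht ht.1
  simp only [mul_zero, Real.exp_zero, one_mul] at h1
  rw [neg_mul, Real.exp_neg, ← div_eq_inv_mul, le_div_iff₀ (Real.exp_pos _)]
  linarith

/-- A solution that starts in a sublevel set of `V` inside the ball of radius `ρ` stays in that
ball: at a first exit time, `V` would be at least `c ρ²`. -/
theorem trapped (hV : IsStrictLyapunov Φ f e V r c μ) {ρ : ℝ} (hρr : ρ < r) {T : ℝ}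
    {γ : ℝ → E} (hγΦ : ∀ t ∈ Set.Icc 0 T, γ t ∈ Φ)
    (hγ : ∀ t ∈ Set.Icc 0 T, HasDerivWithinAt γ (f (γ t)) (Set.Icc 0 T) t)
    (h0 : dist (γ 0) e < ρ) (hV0 : V (γ 0) < c * ρ ^ 2) :
    ∀ t ∈ Set.Icc 0 T, dist (γ t) e < ρ ∧ V (γ t) ≤ Real.exp (-μ * t) * V (γ 0) := by
  have hcont : ContinuousOn (fun t => dist (γ t) e) (Set.Icc 0 T) := fun t ht =>
    (hγ t ht).continuousWithinAt.dist continuousWithinAt_const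
  have hdist : ∀ t ∈ Set.Icc 0 T, dist (γ t) e < ρ := by
    by_contra! hex
    obtain ⟨t₁, ht₁, hρ₁⟩ := hex
    set S := Set.Icc 0 T ∩ (fun t => dist (γ t) e) ⁻¹' Set.Ici ρ with hS
    have hcomp : IsCompact S :=
      isCompact_Icc.of_isClosed_subset (hcont.preimage_isClosed_of_isClosed isClosed_Icc
        isClosed_Ici) Set.inter_subset_left
    obtain ⟨τ, ⟨hτT, hτρ⟩, hτmin⟩ := hcomp.exists_isLeast ⟨t₁, ht₁, hρ₁⟩
    have hbefore : ∀ t ∈ Set.Ico 0 τ, dist (γ t) e < ρ := by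
      intro t ht
      by_contra! hge
      exact absurd (hτmin ⟨⟨ht.1, ht.2.le.trans hτT.2⟩, hge⟩) (not_le.2 ht.2)
    have hsub : Set.Icc 0 τ ⊆ Set.Icc 0 T := Set.Icc_subset_Icc_right hτT.2
    have hVτ := hV.exp_bound (fun t ht => hγΦ t (hsub ht))
      (fun t ht => (hγ t (hsub ht)).mono hsub) (fun t ht => (hbefore t ht).trans hρr)
      (t := τ) ⟨hτT.1, le_rfl⟩
    have hτ0 : 0 < τ := by
      refine lt_of_le_of_ne hτT.1 fun h => ?_
      rw [← h] at hτρ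
      exact absurd h0 (not_lt.2 hτρ)
    have hle : dist (γ τ) e ≤ ρ := by
      have hc : ContinuousWithinAt (fun t => dist (γ t) e) (Set.Ico 0 τ) τ :=
        (hcont τ hτT).mono (Set.Ico_subset_Icc_self.trans hsub)
      have : (𝓝[Set.Ico 0 τ] τ).NeBot :=
        mem_closure_iff_nhdsWithin_neBot.1 (by
          rw [closure_Ico hτ0.ne]; exact ⟨hτ0.le, le_rfl⟩)
      exact le_of_tendsto hc (Filter.eventually_of_mem self_mem_nhdsWithin
        fun t ht => (hbefore t ht).le)
    have hlow := hV.lower _ (hγΦ τ hτT) (hle.trans_lt hρr)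
    have heq : dist (γ τ) e = ρ := le_antisymm hle hτρ
    have hV0n : 0 ≤ V (γ 0) :=
      le_trans (mul_nonneg hV.c_pos.le (sq_nonneg _))
        (hV.lower _ (hγΦ 0 ⟨le_rfl, hτT.1.trans hτT.2⟩) (h0.trans hρr))
    have hexp : Real.exp (-μ * τ) ≤ 1 := Real.exp_le_one_iff.2 (by nlinarith [hV.μ_pos])
    rw [heq] at hlow
    nlinarith
  exact fun t ht => ⟨hdist t ht, hV.exp_bound hγΦ hγ
    (fun t ht => (hdist t (Set.Ico_subset_Icc_self ht)).trans hρr) ht⟩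

/-- Lyapunov's direct method on an invariant set `Φ`, for a differential equation `F` that agrees
on `Φ` with a vector field of class `C¹` near `e`. Solutions exist for all time because the
Picard-Lindelöf time is uniform near `e` and the sublevel sets of `V` are never left. -/
theorem isLocallyAsymptoticallyStable [CompleteSpace E]
    (hV : IsStrictLyapunov Φ f e V r c μ) {F : E → E → Prop} (hf : ContDiffAt ℝ 1 f e)
    (hfe : f e = 0) (he : e ∈ Φ) (hF : ∀ z ∈ Φ, ∀ d, F z d ↔ d = f z)
    (hinv : ∀ (T : ℝ) (γ : ℝ → E), γ 0 ∈ Φ →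
      (∀ t ∈ Set.Icc 0 T, HasDerivWithinAt γ (f (γ t)) (Set.Icc 0 T) t) →
      ∀ t ∈ Set.Icc 0 T, γ t ∈ Φ) :
    IsLocallyAsymptoticallyStable Φ F e := by
  have hsol : ∀ {I : Set ℝ} {γ : ℝ → E}, IsSolutionOn Φ F I γ →
      (∀ t ∈ I, γ t ∈ Φ) ∧ ∀ t ∈ I, HasDerivWithinAt γ (f (γ t)) I t := by
    intro I γ h
    refine ⟨fun t ht => (h t ht).1, fun t ht => ?_⟩
    obtain ⟨h1, d, h2, h3⟩ := h t ht
    rwa [← (hF _ h1 d).1 h3]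
  have hsmall : ∀ ρ > 0, ∃ δ > 0, ∀ z, dist z e < δ → dist z e < ρ ∧ V z < c * ρ ^ 2 := by
    intro ρ hρ
    have h1 : ∀ᶠ z in 𝓝 e, V z < c * ρ ^ 2 := by
      refine (hV.differentiable e).continuousAt.eventually_lt continuousAt_const ?_
      rw [hV.apply_self]
      have := hV.c_pos
      positivity
    obtain ⟨δ, hδ, h2⟩ := Metric.eventually_nhds_iff.1 (h1.and (Metric.ball_mem_nhds e hρ))
    exact ⟨δ, hδ, fun z hz => ⟨(h2 hz).2, (h2 hz).1⟩⟩
  refine ⟨⟨he, (hF e he 0).2 hfe.symm⟩, fun ε hε => ?_, ?_⟩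
  · obtain ⟨r₀, hr₀, η, hη, hpic⟩ :=
      hf.exists_forall_mem_closedBall_exists_eq_forall_mem_Ioo_hasDerivAt 0
    set ρ := min (min ε r₀) (r / 2) with hρ
    have hρ0 : 0 < ρ := lt_min (lt_min hε hr₀) (half_pos hV.r_pos)
    have hρε : ρ ≤ ε := (min_le_left _ _).trans (min_le_left _ _)
    have hρr₀ : ρ ≤ r₀ := (min_le_left _ _).trans (min_le_right _ _)
    have hρr : ρ < r := (min_le_right _ _).trans_lt (half_lt_self hV.r_pos)
    obtain ⟨δ, hδ, hδρ⟩ := hsmall ρ hρ0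
    refine ⟨δ, hδ, fun z hz hzδ => ⟨?_, ?_⟩⟩
    · set S : Set E := {z | z ∈ Φ ∧ dist z e < ρ ∧ V z < c * ρ ^ 2} with hS
      obtain ⟨γ, hγ0, hγ⟩ := exists_glued_solution (f := f) (S := S) (half_pos hη)
        (fun z hz => by
          obtain ⟨α, hα0, hα⟩ := hpic z (Metric.mem_closedBall.2 (hz.2.1.le.trans hρr₀))
          have hα' : ∀ t ∈ Set.Icc 0 (η / 2),
              HasDerivWithinAt α (f (α t)) (Set.Icc 0 (η / 2)) t := fun t ht =>
            (hα t ⟨by linarith [ht.1], by linarith [ht.2]⟩).hasDerivWithinAt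
          have hαΦ := hinv _ α (hα0 ▸ hz.1) hα'
          refine ⟨α, hα0, fun t ht => ⟨?_, hα' t ht⟩⟩
          obtain ⟨h1, h2⟩ := hV.trapped hρr hαΦ hα' (hα0 ▸ hz.2.1) (hα0 ▸ hz.2.2) t ht
          refine ⟨hαΦ t ht, h1, h2.trans_lt ?_⟩
          rw [hα0]
          have hz0 : 0 ≤ V z := le_trans (mul_nonneg hV.c_pos.le (sq_nonneg _))
            (hV.lower _ hz.1 (hz.2.1.trans hρr))
          have hexp : Real.exp (-μ * t) ≤ 1 :=
            Real.exp_le_one_iff.2 (by nlinarith [hV.μ_pos, ht.1])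
          have hz2 := hz.2.2
          nlinarith)
        (show z ∈ S from ⟨hz, hδρ z hzδ⟩)
      exact ⟨γ, hγ0, fun t ht => ⟨(hγ t ht).1.1, f (γ t), (hγ t ht).2,
        (hF _ (hγ t ht).1.1 _).2 rfl⟩⟩
    · intro T hT γ hγ0 hγ t ht
      obtain ⟨h1, h2⟩ := hsol hγ
      have hsub : Set.Icc 0 t ⊆ Set.Ico 0 T := fun x hx => ⟨hx.1, hx.2.trans_lt ht.2⟩
      have h3 := hδρ z hzδ
      rw [← hγ0] at h3
      exact ((hV.trapped hρr (fun x hx => h1 x (hsub hx))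
        (fun x hx => (h2 x (hsub hx)).mono hsub) h3.1 h3.2) t ⟨ht.1, le_rfl⟩).1.trans_le hρε
  · have hρr := half_lt_self hV.r_pos
    obtain ⟨δ, hδ, hδρ⟩ := hsmall _ (half_pos hV.r_pos)
    refine ⟨δ, hδ, fun z hz hzδ γ hγ0 hγ => ?_⟩
    obtain ⟨h1, h2⟩ := hsol hγ
    have h3 := hδρ z hzδ
    rw [← hγ0] at h3
    have hbound : ∀ t ∈ Set.Ici (0 : ℝ),
        dist (γ t) e ^ 2 ≤ Real.exp (-μ * t) * V (γ 0) / c := by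
      intro t ht
      have hsub : Set.Icc 0 t ⊆ Set.Ici 0 := fun x hx => hx.1
      obtain ⟨h4, h5⟩ := hV.trapped hρr (fun x hx => h1 x (hsub hx))
        (fun x hx => (h2 x (hsub hx)).mono hsub) h3.1 h3.2 t ⟨ht, le_rfl⟩
      rw [le_div_iff₀ hV.c_pos, mul_comm]
      exact (hV.lower _ (h1 t ht) (h4.trans hρr)).trans h5
    have hexp : Filter.Tendsto (fun t => Real.exp (-μ * t) * V (γ 0) / c) Filter.atTop (𝓝 0) := by
      have h4 : Filter.Tendsto (fun t : ℝ => -μ * t) Filter.atTop Filter.atBot :=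
        Filter.tendsto_id.const_mul_atTop_of_neg (neg_lt_zero.2 hV.μ_pos)
      simpa using ((Real.tendsto_exp_atBot.comp h4).mul_const (V (γ 0))).div_const c
    have hsq : Filter.Tendsto (fun t => dist (γ t) e ^ 2) Filter.atTop (𝓝 0) :=
      squeeze_zero' (Filter.Eventually.of_forall fun t => sq_nonneg _)
        (Filter.eventually_of_mem (Filter.Ici_mem_atTop 0) hbound) hexp
    rw [tendsto_iff_dist_tendsto_zero]
    have := hsq.sqrt
    simpa [Real.sqrt_sq dist_nonneg] using this

end IsStrictLyapunov

/-- Lyapunov's indirect method. The linearization of `f` at `e` need only be understood after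
a linear map `L` which is, on `Φ` near `e`, bounded below: if `L` intertwines `f'(e)` with `A`, a
quadratic Lyapunov function `y ↦ b y y` of `y' = A y` pulls back to one for `f` on `Φ`. -/
theorem exists_isStrictLyapunov {Y : Type*} [NormedAddCommGroup Y] [NormedSpace ℝ Y]
    {Φ : Set E} {f : E → E} {e : E} {D : E →L[ℝ] E} (hD : HasFDerivAt f D e) (hfe : f e = 0)
    (L : E →L[ℝ] Y) (A : Y →L[ℝ] Y) (hLD : ∀ ζ, L (D ζ) = A (L ζ))
    {r C : ℝ} (hr : 0 < r) (hC : 0 < C)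
    (hLC : ∀ z ∈ Φ, dist z e < r → dist z e ≤ C * ‖L (z - e)‖)
    (b : Y →L[ℝ] Y →L[ℝ] ℝ) (hbsymm : ∀ y y', b y y' = b y' y)
    {c μ : ℝ} (hc : 0 < c) (hμ : 0 < μ) (hb : ∀ y, c * ‖y‖ ^ 2 ≤ b y y)
    (hbA : ∀ y, 2 * b y (A y) = -μ * b y y) :
    ∃ V r' c', IsStrictLyapunov Φ f e V r' c' (μ / 2) := by
  set η := c * μ / (4 * (‖b‖ * ‖L‖ * C + 1)) with hη
  have hη0 : 0 < η := by positivity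
  have hηb : 2 * (‖b‖ * ‖L‖ * C * η) ≤ c * μ / 2 := by
    rw [hη]
    have hk : 0 ≤ ‖b‖ * ‖L‖ * C := by positivity
    generalize ‖b‖ * ‖L‖ * C = k at hk
    rw [show 2 * (k * (c * μ / (4 * (k + 1)))) = (k * (c * μ) / (2 * (k + 1))) by
      field_simp; ring, div_le_div_iff₀ (by positivity) two_pos]
    have := mul_pos hc hμ
    nlinarith
  have hlo := (hasFDerivAt_iff_isLittleO_nhds_zero.1 hD).def hη0
  have hlo' : ∀ᶠ z in 𝓝 e, ‖f z - D (z - e)‖ ≤ η * ‖z - e‖ := by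
    have ht : Filter.Tendsto (fun z => z - e) (𝓝 e) (𝓝 0) := by
      have : Continuous fun z : E => z - e := by fun_prop
      simpa using this.tendsto e
    filter_upwards [ht.eventually hlo] with z hz
    simpa [hfe] using hz
  obtain ⟨r₁, hr₁, hf₁⟩ := Metric.eventually_nhds_iff.1 hlo'
  have hVd : ∀ z, HasFDerivAt (fun z => b (L (z - e)) (L (z - e)))
      ((b (L (z - e))).comp L + (b.flip (L (z - e))).comp L) z := by
    intro z
    have h1 : HasFDerivAt (fun z => L (z - e)) L z :=
      L.hasFDerivAt.comp z ((hasFDerivAt_id z).sub_const e)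
    have h2 := (b.hasFDerivAt.comp z h1).clm_apply h1
    exact h2
  refine ⟨fun z => b (L (z - e)) (L (z - e)), min r r₁, c / C ^ 2, lt_min hr hr₁, by positivity,
    half_pos hμ, by simp, fun z => (hVd z).differentiableAt, fun z hz hzr => ?_,
    fun z hz hzr => ?_⟩
  · have h1 := hLC z hz (hzr.trans_le (min_le_left _ _))
    refine le_trans ?_ (hb _)
    rw [div_mul_eq_mul_div, div_le_iff₀ (by positivity), mul_assoc]
    refine mul_le_mul_of_nonneg_left ?_ hc.le
    calc dist z e ^ 2 ≤ (C * ‖L (z - e)‖) ^ 2 := pow_le_pow_left₀ dist_nonneg h1 2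
      _ = ‖L (z - e)‖ ^ 2 * C ^ 2 := by ring
  · have h1 := hLC z hz (hzr.trans_le (min_le_left _ _))
    have h2 := hf₁ (hzr.trans_le (min_le_right _ _))
    rw [(hVd z).fderiv]
    set y := L (z - e) with hy
    set R := f z - D (z - e) with hR
    have h3 : L (f z) = A y + L R := by
      rw [hR, map_sub, hLD, hy]; abel
    have h4 : b y (L R) ≤ ‖b‖ * ‖L‖ * C * η * ‖y‖ ^ 2 := by
      calc b y (L R) ≤ ‖b y (L R)‖ := Real.le_norm_self _
        _ ≤ ‖b‖ * ‖y‖ * ‖L R‖ := b.le_opNorm₂ _ _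
        _ ≤ ‖b‖ * ‖y‖ * (‖L‖ * (η * (C * ‖y‖))) := by
          rw [dist_eq_norm] at h1
          gcongr
          refine (L.le_opNorm R).trans ?_
          gcongr
          exact h2.trans (by gcongr)
        _ = _ := by ring
    have h5 : ((b y).comp L + (b.flip y).comp L) (f z) = 2 * b y (A y) + 2 * b y (L R) := by
      simp only [add_apply, ContinuousLinearMap.comp_apply,
        ContinuousLinearMap.flip_apply, h3, map_add]
      rw [hbsymm (A y), hbsymm (L R)]; ring
    rw [h5, hbA]
    have h6 := hb y
    have h7 := mul_le_mul_of_nonneg_right hηb (sq_nonneg ‖y‖)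
    nlinarith

end Lyapunov

/-! ### The inertia operator -/

section Mechanics

variable {n : ℕ} (P : Params n)

namespace Params

theorem outerMass_eq (i : Fin n) : P.outerMass i = ∑ a, if i ≤ a then P.mass a else 0 := by
  rw [outerMass, ← Finset.sum_filter]
  congr 1
  ext a
  simp

theorem outerMass_pos (i : Fin n) : 0 < P.outerMass i :=
  Finset.sum_pos (fun a _ => P.mass_pos a) ⟨i, by simp⟩

theorem Mq_self_pos (i : Fin n) : 0 < P.Mq i i :=
  mul_pos (mul_pos (P.outerMass_pos _) (P.length_pos i)) (P.length_pos i)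

/-- König's formula in one coordinate, for a cart with velocity `d` and no mass of its own. -/
theorem sum_mass_sq (d : ℝ) (x : Fin n → ℝ) :
    ∑ a, P.mass a * (d - ∑ i, if i ≤ a then P.length i * x i else 0) ^ 2
      = (∑ a, P.mass a) * (d * d) - 2 * ∑ j, P.outerMass j * P.length j * (d * x j)
        + ∑ i, ∑ j, P.Mq i j * (x i * x j) := by
  have h1 : ∑ j, P.outerMass j * P.length j * (d * x j)
      = ∑ a, P.mass a * (d * ∑ i, if i ≤ a then P.length i * x i else 0) := by
    simp only [outerMass_eq, Finset.sum_mul, Finset.mul_sum]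
    rw [Finset.sum_comm]
    refine Finset.sum_congr rfl fun a _ => Finset.sum_congr rfl fun i _ => ?_
    split_ifs <;> ring
  have h2 : ∑ i, ∑ j, P.Mq i j * (x i * x j)
      = ∑ a, P.mass a * ((∑ i, if i ≤ a then P.length i * x i else 0)
          * ∑ j, if j ≤ a then P.length j * x j else 0) := by
    have h3 : ∀ i j, P.Mq i j * (x i * x j) = ∑ a, P.mass a
        * ((if i ≤ a then P.length i * x i else 0) * if j ≤ a then P.length j * x j else 0) := by
      intro i j
      simp only [Mq, outerMass_eq, Finset.sum_mul, max_le_iff]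
      refine Finset.sum_congr rfl fun a _ => ?_
      by_cases hi : i ≤ a <;> by_cases hj : j ≤ a <;> simp [hi, hj]
      ring
    simp only [h3]
    rw [Finset.sum_congr rfl fun i _ => Finset.sum_comm, Finset.sum_comm]
    exact Finset.sum_congr rfl fun a _ => by
      rw [Finset.sum_mul_sum, Finset.mul_sum]
      exact Finset.sum_congr rfl fun i _ => (Finset.mul_sum _ _ _).symm
  rw [h1, h2, Finset.sum_mul, Finset.mul_sum, ← Finset.sum_sub_distrib, ← Finset.sum_add_distrib]
  exact Finset.sum_congr rfl fun a _ => by ring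

end Params

theorem hat_mulVec_eq (x y : Fin 3 → ℝ) :
    hat x *ᵥ y = ![x 1 * y 2 - x 2 * y 1, x 2 * y 0 - x 0 * y 2, x 0 * y 1 - x 1 * y 0] := by
  rw [hat_mulVec, cross_apply]

theorem dotProduct_hat_self (x y : Fin 3 → ℝ) : (hat x *ᵥ y) ⬝ᵥ x = 0 := by
  simp [hat_mulVec_eq, dotProduct, Fin.sum_univ_three]; ring

theorem hat_dotProduct_self (x y : Fin 3 → ℝ) : (hat x *ᵥ y) ⬝ᵥ y = 0 := by
  simp [hat_mulVec_eq, dotProduct, Fin.sum_univ_three]; ring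

theorem dotProduct_hat (x y w : Fin 3 → ℝ) : w ⬝ᵥ (hat x *ᵥ y) = -((hat x *ᵥ w) ⬝ᵥ y) := by
  simp [hat_mulVec_eq, dotProduct, Fin.sum_univ_three]; ring

theorem hat_dotProduct_hat (x y : Fin 3 → ℝ) :
    (hat x *ᵥ y) ⬝ᵥ (hat x *ᵥ y) = (x ⬝ᵥ x) * (y ⬝ᵥ y) - (y ⬝ᵥ x) ^ 2 := by
  simp [hat_mulVec_eq, dotProduct, Fin.sum_univ_three]; ring

theorem C_mulVec (c : Fin 2 → ℝ) : C *ᵥ c = ![c 0, c 1, 0] := by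
  ext i; fin_cases i <;> simp [C, Matrix.mulVec, dotProduct, Fin.sum_univ_two]

theorem C_transpose_mulVec (y : Fin 3 → ℝ) : Cᵀ *ᵥ y = ![y 0, y 1] := by
  ext i; fin_cases i <;> simp [C, Matrix.mulVec, dotProduct, Fin.sum_univ_three]

theorem hat_e3_mulVec (y : Fin 3 → ℝ) : hat e3 *ᵥ y = ![-y 1, y 0, 0] := by
  rw [hat_mulVec_eq]; simp [e3]

theorem hat_smul (a : ℝ) (x : Fin 3 → ℝ) : hat (a • x) = a • hat x := by
  ext i j; fin_cases i <;> fin_cases j <;> simp [hat]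

theorem hat_add (x y : Fin 3 → ℝ) : hat (x + y) = hat x + hat y := by
  ext i j; fin_cases i <;> fin_cases j <;> simp [hat] <;> ring

/-- Cart acceleration and angular accelerations of the links. -/
abbrev Acc (n : ℕ) : Type := (Fin 2 → ℝ) × (Fin n → Fin 3 → ℝ)

/-- The left-hand side of the equations of motion, as a linear map in the accelerations. -/
noncomputable def inertia (q : Fin n → Fin 3 → ℝ) : Acc n →L[ℝ] Acc n :=
  LinearMap.toContinuousLinearMap
    { toFun := fun a =>
        (P.M00 • a.1 - ∑ j, P.M0 j *ᵥ (hat (q j) *ᵥ a.2 j),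
          fun i => hat (q i) *ᵥ ((P.M0 i)ᵀ *ᵥ a.1) + P.Mq i i • a.2 i
            - ∑ j ∈ Finset.univ.erase i, P.Mq i j • (hat (q i) *ᵥ (hat (q j) *ᵥ a.2 j)))
      map_add' := fun a b => by
        ext i
        · simp only [Prod.fst_add, Prod.snd_add, Pi.add_apply, Matrix.mulVec_add,
            Finset.sum_add_distrib, smul_add, Pi.sub_apply]
          ring
        · simp only [Prod.fst_add, Prod.snd_add, Pi.add_apply, Matrix.mulVec_add,
            Finset.sum_add_distrib, smul_add, Pi.sub_apply]
          ring
      map_smul' := fun c a => by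
        ext i
        · simp only [Prod.smul_fst, Prod.smul_snd, Pi.smul_apply, Matrix.mulVec_smul,
            ← Finset.smul_sum, smul_comm _ c, ← smul_sub, RingHom.id_apply]
        · simp only [Prod.smul_fst, Prod.smul_snd, Pi.smul_apply, Matrix.mulVec_smul,
            ← Finset.smul_sum, smul_comm _ c, ← smul_add, ← smul_sub, RingHom.id_apply] }

theorem inertia_apply (q : Fin n → Fin 3 → ℝ) (a : Acc n) : inertia P q a =
    (P.M00 • a.1 - ∑ j, P.M0 j *ᵥ (hat (q j) *ᵥ a.2 j),
      fun i => hat (q i) *ᵥ ((P.M0 i)ᵀ *ᵥ a.1) + P.Mq i i • a.2 i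
        - ∑ j ∈ Finset.univ.erase i, P.Mq i j • (hat (q i) *ᵥ (hat (q j) *ᵥ a.2 j))) := rfl

/-- The part of the right-hand side of the equations of motion that is quadratic in the angular
velocities. -/
def centrifugal (q w : Fin n → Fin 3 → ℝ) : Acc n :=
  (∑ j, (w j ⬝ᵥ w j) • (P.M0 j *ᵥ q j),
    fun i => ∑ j ∈ Finset.univ.erase i, (P.Mq i j * (w j ⬝ᵥ w j)) • (hat (q i) *ᵥ q j))

/-- The control force and the moments of gravity. -/
def appliedForce (u : Fin 2 → ℝ) (q : Fin n → Fin 3 → ℝ) : Acc n :=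
  (u, fun i => (P.outerMass i * P.g * P.length i) • (hat (q i) *ᵥ e3))

theorem eulerLagrange_iff (u : Fin 2 → ℝ) (z d : State n) :
    EulerLagrange P u z d ↔ d.1 = z.2.1 ∧ (∀ i, d.2.2.1 i = hat (z.2.2.2 i) *ᵥ z.2.2.1 i) ∧
      inertia P z.2.2.1 (d.2.1, d.2.2.2)
        = centrifugal P z.2.2.1 z.2.2.2 + appliedForce P u z.2.2.1 := by
  obtain ⟨x, v, q, w⟩ := z
  obtain ⟨dx, dv, dq, dw⟩ := d
  simp only [EulerLagrange, inertia_apply, centrifugal, appliedForce, Prod.mk_add_mk,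
    Prod.mk.injEq, ← Matrix.mulVec_mulVec, funext_iff (f := fun i => _ - _), Pi.add_apply]

theorem inertia_snd_dotProduct (q : Fin n → Fin 3 → ℝ) (a : Acc n) (i : Fin n) :
    (inertia P q a).2 i ⬝ᵥ q i = P.Mq i i * (a.2 i ⬝ᵥ q i) := by
  simp only [inertia_apply, sub_dotProduct, add_dotProduct, sum_dotProduct, smul_dotProduct,
    dotProduct_hat_self, smul_eq_mul, mul_zero, Finset.sum_const_zero, zero_add, sub_zero]

theorem force_snd_dotProduct (u : Fin 2 → ℝ) (q w : Fin n → Fin 3 → ℝ) (i : Fin n) :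
    (centrifugal P q w + appliedForce P u q).2 i ⬝ᵥ q i = 0 := by
  simp only [centrifugal, appliedForce, Prod.mk_add_mk, Pi.add_apply, add_dotProduct,
    sum_dotProduct, smul_dotProduct, dotProduct_hat_self, smul_eq_mul, mul_zero,
    Finset.sum_const_zero, zero_add]

/-- König's formula: twice the kinetic energy of the cart and the links, when link `i` moves
relative to its inboard end with velocity `-lᵢ yᵢ`. -/
theorem kinetic_energy (c : Fin 2 → ℝ) (y : Fin n → Fin 3 → ℝ) :
    P.M00 * (c ⬝ᵥ c) - 2 * ∑ j, c ⬝ᵥ (P.M0 j *ᵥ y j) + ∑ i, ∑ j, P.Mq i j * (y i ⬝ᵥ y j)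
      = P.cartMass * (c ⬝ᵥ c)
        + ∑ k, ∑ a, P.mass a
            * ((C *ᵥ c) k - ∑ i, if i ≤ a then P.length i * y i k else 0) ^ 2 := by
  have h1 : ∀ j, c ⬝ᵥ (P.M0 j *ᵥ y j)
      = ∑ k, P.outerMass j * P.length j * ((C *ᵥ c) k * y j k) := by
    intro j
    rw [Params.M0, Matrix.smul_mulVec, C_transpose_mulVec, C_mulVec]
    simp [dotProduct, Fin.sum_univ_two, Fin.sum_univ_three]
    ring
  have h2 : c ⬝ᵥ c = ∑ k, (C *ᵥ c) k * (C *ᵥ c) k := by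
    rw [C_mulVec]
    simp [dotProduct, Fin.sum_univ_two, Fin.sum_univ_three]
  have h3 : ∑ i, ∑ j, P.Mq i j * (y i ⬝ᵥ y j) = ∑ k, ∑ i, ∑ j, P.Mq i j * (y i k * y j k) := by
    simp only [dotProduct, Finset.mul_sum]
    rw [Finset.sum_congr rfl fun i _ => Finset.sum_comm, Finset.sum_comm]
  have h4 : ∑ j, c ⬝ᵥ (P.M0 j *ᵥ y j)
      = ∑ k, ∑ j, P.outerMass j * P.length j * ((C *ᵥ c) k * y j k) := by
    simp only [h1]
    exact Finset.sum_comm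
  rw [h3, h2, h4]
  simp only [Params.sum_mass_sq, Finset.sum_add_distrib, Finset.sum_sub_distrib, Params.M00,
    ← Finset.mul_sum]
  ring

/-- The inertia operator is injective at every configuration: if it annihilates the
accelerations `a`, then each `a.2 i` is orthogonal to `q i`, and pairing with `a` gives twice the
kinetic energy for the velocities `a`, which is positive definite. -/
theorem inertia_injective {q : Fin n → Fin 3 → ℝ} (hq : ∀ i, q i ⬝ᵥ q i = 1) {a : Acc n}
    (ha : inertia P q a = 0) : a = 0 := by
  have horth : ∀ i, a.2 i ⬝ᵥ q i = 0 := fun i => by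
    have h := inertia_snd_dotProduct P q a i
    rw [ha] at h
    simp only [Prod.snd_zero, Pi.zero_apply, zero_dotProduct] at h
    exact (mul_eq_zero.1 h.symm).resolve_left (P.Mq_self_pos i).ne'
  set y : Fin n → Fin 3 → ℝ := fun i => hat (q i) *ᵥ a.2 i with hy
  have hnorm : ∀ i, y i ⬝ᵥ y i = a.2 i ⬝ᵥ a.2 i := fun i => by
    simp only [hy]
    rw [hat_dotProduct_hat, hq, horth]; ring
  rw [inertia_apply, Prod.mk_eq_zero] at ha
  obtain ⟨ha1, ha2⟩ := ha
  have h1 : P.M00 * (a.1 ⬝ᵥ a.1) - ∑ j, a.1 ⬝ᵥ (P.M0 j *ᵥ y j) = 0 := by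
    have := congrArg (a.1 ⬝ᵥ ·) ha1
    simpa only [dotProduct_sub, dotProduct_smul, smul_eq_mul, dotProduct_sum,
      dotProduct_zero] using this
  have h2 : ∀ i, ∑ j, P.Mq i j * (y i ⬝ᵥ y j) - a.1 ⬝ᵥ (P.M0 i *ᵥ y i) = 0 := by
    intro i
    have h : hat (q i) *ᵥ ((P.M0 i)ᵀ *ᵥ a.1) + P.Mq i i • a.2 i
        - ∑ j ∈ Finset.univ.erase i, P.Mq i j • (hat (q i) *ᵥ y j) = 0 := congrFun ha2 i
    replace h := congrArg (a.2 i ⬝ᵥ ·) h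
    simp only [dotProduct_sub, dotProduct_add, dotProduct_smul, smul_eq_mul, dotProduct_sum,
      dotProduct_zero, dotProduct_hat, ← hnorm, mul_neg,
      Finset.sum_neg_distrib, show hat (q i) *ᵥ a.2 i = y i from rfl] at h
    rw [← Finset.add_sum_erase _ _ (Finset.mem_univ i), Matrix.dotProduct_mulVec a.1,
      ← Matrix.mulVec_transpose, dotProduct_comm ((P.M0 i)ᵀ *ᵥ a.1)]
    linarith
  have h3 := kinetic_energy P a.1 y
  have h4 := Finset.sum_congr rfl fun i (_ : i ∈ Finset.univ) => h2 i
  rw [Finset.sum_sub_distrib, Finset.sum_const_zero] at h4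
  have hnn : ∀ k : Fin 3, ∀ b, 0 ≤ P.mass b
      * ((C *ᵥ a.1) k - ∑ i, if i ≤ b then P.length i * y i k else 0) ^ 2 := fun k b =>
    mul_nonneg (P.mass_pos b).le (sq_nonneg _)
  have hsum := Finset.sum_nonneg fun k (_ : k ∈ Finset.univ) =>
    Finset.sum_nonneg fun b (_ : b ∈ Finset.univ) => hnn k b
  have hc0 : 0 ≤ a.1 ⬝ᵥ a.1 := Finset.sum_nonneg fun _ _ => mul_self_nonneg _
  have hm := P.cartMass_pos
  have hc : a.1 ⬝ᵥ a.1 = 0 := by nlinarith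
  have hc' : a.1 = 0 := dotProduct_self_eq_zero.1 hc
  have hsum0 : ∑ k : Fin 3, ∑ b, P.mass b
      * ((C *ᵥ a.1) k - ∑ i, if i ≤ b then P.length i * y i k else 0) ^ 2 = 0 := by
    rw [hc] at h1 h3; linarith
  rw [Finset.sum_eq_zero_iff_of_nonneg fun k _ => Finset.sum_nonneg fun b _ => hnn k b] at hsum0
  have hpart : ∀ k b, ∑ i, (if i ≤ b then P.length i * y i k else 0) = 0 := by
    intro k b
    have h5 := hsum0 k (Finset.mem_univ k)
    rw [Finset.sum_eq_zero_iff_of_nonneg fun b _ => hnn k b] at h5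
    have h6 := (mul_eq_zero.1 (h5 b (Finset.mem_univ b))).resolve_left (P.mass_pos b).ne'
    rw [hc', Matrix.mulVec_zero, Pi.zero_apply, zero_sub, neg_sq] at h6
    exact pow_eq_zero_iff two_ne_zero |>.1 h6
  have hy0 : ∀ b, y b = 0 := by
    intro b
    induction b using WellFoundedLT.induction with
    | ind b ih =>
      ext k
      have h7 := hpart k b
      rw [Finset.sum_eq_single b] at h7
      · rw [if_pos le_rfl] at h7
        exact (mul_eq_zero.1 h7).resolve_left (P.length_pos b).ne'
      · intro i _ hib
        split_ifs with hle
        · rw [ih i (lt_of_le_of_ne hle hib)]; simp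
        · rfl
      · simp
  refine Prod.ext hc' (funext fun i => ?_)
  have := hnorm i
  rw [hy0 i, zero_dotProduct] at this
  exact dotProduct_self_eq_zero.1 this.symm

end Mechanics

/-! ### Differentiability of products -/

section Smooth

variable {X : Type*} [NormedAddCommGroup X] [NormedSpace ℝ X] {m : WithTop ℕ∞} {x₀ : X}

@[fun_prop]
theorem contDiffAt_mulVec {ι κ : Type*} [Fintype ι] [Fintype κ] (M : Matrix ι κ ℝ)
    {g : X → κ → ℝ} (hg : ContDiffAt ℝ m g x₀) : ContDiffAt ℝ m (fun x => M *ᵥ g x) x₀ :=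
  (LinearMap.toContinuousLinearMap M.mulVecLin).contDiff.contDiffAt.comp x₀ hg

@[fun_prop]
theorem contDiffAt_dotProduct {ι : Type*} [Fintype ι] {f g : X → ι → ℝ}
    (hf : ContDiffAt ℝ m f x₀) (hg : ContDiffAt ℝ m g x₀) :
    ContDiffAt ℝ m (fun x => f x ⬝ᵥ g x) x₀ :=
  ContDiffAt.sum fun i _ => (contDiffAt_pi.1 hf i).mul (contDiffAt_pi.1 hg i)

@[fun_prop]
theorem contDiffAt_hat_mulVec {f g : X → Fin 3 → ℝ} (hf : ContDiffAt ℝ m f x₀)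
    (hg : ContDiffAt ℝ m g x₀) : ContDiffAt ℝ m (fun x => hat (f x) *ᵥ g x) x₀ := by
  rw [contDiffAt_pi] at hf hg ⊢
  intro i
  simp only [hat_mulVec_eq]
  fin_cases i
  · exact ((hf 1).mul (hg 2)).sub ((hf 2).mul (hg 1))
  · exact ((hf 2).mul (hg 0)).sub ((hf 0).mul (hg 2))
  · exact ((hf 0).mul (hg 1)).sub ((hf 1).mul (hg 0))

theorem hasDerivAt_smul_add_sq_smul {a : X} {R : ℝ → X} (hR : ContDiffAt ℝ 1 R 0) :
    HasDerivAt (fun t : ℝ => t • a + t ^ 2 • R t) a 0 := by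
  have h1 := (hasDerivAt_id (0 : ℝ)).smul_const a
  have h2 := (hasDerivAt_pow 2 (0 : ℝ)).fun_smul (hR.differentiableAt one_ne_zero).hasDerivAt
  simpa using h1.fun_add h2

theorem hasDerivWithinAt_dotProduct {ι : Type*} [Fintype ι] {f g : ℝ → ι → ℝ} {f' g' : ι → ℝ}
    {I : Set ℝ} {t : ℝ} (hf : HasDerivWithinAt f f' I t) (hg : HasDerivWithinAt g g' I t) :
    HasDerivWithinAt (fun t => f t ⬝ᵥ g t) (f' ⬝ᵥ g t + f t ⬝ᵥ g') I t := by
  rw [hasDerivWithinAt_pi] at hf hg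
  have h := HasDerivWithinAt.fun_sum (u := Finset.univ) fun i _ => (hf i).mul (hg i)
  rw [Finset.sum_add_distrib] at h
  exact h

end Smooth

/-! ### The closed-loop vector field -/

section VectorField

variable {n : ℕ} (P : Params n)

theorem contDiff_inertia : ContDiff ℝ 1 (inertia P) := by
  rw [contDiff_clm_apply_iff]
  intro a
  rw [contDiff_iff_contDiffAt]
  intro q
  simp only [inertia_apply]
  refine ContDiffAt.prodMk (by fun_prop) (contDiffAt_pi.2 fun i => ?_)
  fun_prop

theorem isInvertible_inertia {q : Fin n → Fin 3 → ℝ} (hq : ∀ i, q i ⬝ᵥ q i = 1) :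
    (inertia P q).IsInvertible := by
  have hinj : Function.Injective (inertia P q : Acc n →ₗ[ℝ] Acc n) :=
    (injective_iff_map_eq_zero _).2 fun a ha => inertia_injective P hq ha
  exact ⟨(LinearEquiv.ofInjectiveEndo _ hinj).toContinuousLinearEquiv, by ext <;> rfl⟩

theorem isOpen_setOf_isInvertible_inertia :
    IsOpen {q : Fin n → Fin 3 → ℝ | (inertia P q).IsInvertible} := by
  have h : {q : Fin n → Fin 3 → ℝ | (inertia P q).IsInvertible}
      = inertia P ⁻¹' Set.range ((↑) : (Acc n ≃L[ℝ] Acc n) → Acc n →L[ℝ] Acc n) := rfl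
  rw [h]
  exact (ContinuousLinearEquiv.isOpen).preimage (contDiff_inertia P).continuous

/-- The accelerations determined by the equations of motion. -/
noncomputable def acceleration (u : State n → Fin 2 → ℝ) (z : State n) : Acc n :=
  (inertia P z.2.2.1).inverse
    (centrifugal P z.2.2.1 z.2.2.2 + appliedForce P (u z) z.2.2.1)

/-- The closed-loop vector field on the space of all tuples `(x, ẋ, q, ω)`, meaningful where the
inertia operator is invertible. -/
noncomputable def vectorField (u : State n → Fin 2 → ℝ) (z : State n) : State n :=
  (z.2.1, (acceleration P u z).1, fun i => hat (z.2.2.2 i) *ᵥ z.2.2.1 i, (acceleration P u z).2)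

theorem inertia_acceleration (u : State n → Fin 2 → ℝ) {z : State n}
    (hz : (inertia P z.2.2.1).IsInvertible) :
    inertia P z.2.2.1 (acceleration P u z)
      = centrifugal P z.2.2.1 z.2.2.2 + appliedForce P (u z) z.2.2.1 :=
  hz.self_apply_inverse _

theorem eulerLagrange_iff_eq_vectorField (u : State n → Fin 2 → ℝ) {z : State n}
    (hz : (inertia P z.2.2.1).IsInvertible) (d : State n) :
    EulerLagrange P (u z) z d ↔ d = vectorField P u z := by
  rw [eulerLagrange_iff, ← inertia_acceleration P u hz, hz.injective.eq_iff]
  obtain ⟨dx, dv, dq, dw⟩ := d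
  simp only [vectorField, Prod.mk.injEq, funext_iff (f := dq), Prod.ext_iff (x := (dv, dw))]
  tauto

theorem contDiffAt_forces {u : State n → Fin 2 → ℝ} {z : State n} (hu : ContDiffAt ℝ 1 u z) :
    ContDiffAt ℝ 1 (fun z : State n =>
      centrifugal P z.2.2.1 z.2.2.2 + appliedForce P (u z) z.2.2.1) z := by
  refine ContDiffAt.add (ContDiffAt.prodMk ?_ ?_) (ContDiffAt.prodMk hu ?_)
  · fun_prop
  · rw [contDiffAt_pi]
    intro i
    fun_prop
  · rw [contDiffAt_pi]
    intro i
    fun_prop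

theorem contDiffAt_acceleration {u : State n → Fin 2 → ℝ} {z : State n}
    (hu : ContDiffAt ℝ 1 u z) (hz : (inertia P z.2.2.1).IsInvertible) :
    ContDiffAt ℝ 1 (acceleration P u) z := by
  have h1 : ContDiffAt ℝ 1 (fun z : State n => inertia P z.2.2.1) z :=
    (contDiff_inertia P).contDiffAt.comp z (by fun_prop)
  exact (ContDiffAt.comp z hz.contDiffAt_map_inverse h1).clm_apply (contDiffAt_forces P hu)

theorem contDiffAt_vectorField {u : State n → Fin 2 → ℝ} {z : State n}
    (hu : ContDiffAt ℝ 1 u z) (hz : (inertia P z.2.2.1).IsInvertible) :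
    ContDiffAt ℝ 1 (vectorField P u) z := by
  have h := contDiffAt_acceleration P hu hz
  unfold vectorField
  have h2 : ContDiffAt ℝ 1
      (fun z : State n => fun i => hat (z.2.2.2 i) *ᵥ z.2.2.1 i) z := by
    rw [contDiffAt_pi]
    intro i
    fun_prop
  fun_prop

/-- The phase space is invariant: `q i ⬝ᵥ q i` is conserved along the vector field, so that the
inertia operator is invertible along the solution, and then `ω i ⬝ᵥ q i` is conserved as well,
since the moments on link `i` are all orthogonal to `q i`. -/
theorem mem_phaseSpace_of_solution (u : State n → Fin 2 → ℝ) (T : ℝ) (γ : ℝ → State n)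
    (h0 : γ 0 ∈ phaseSpace n)
    (hγ : ∀ t ∈ Set.Icc 0 T, HasDerivWithinAt γ (vectorField P u (γ t)) (Set.Icc 0 T) t) :
    ∀ t ∈ Set.Icc 0 T, γ t ∈ phaseSpace n := by
  have hconst : ∀ h : ℝ → ℝ, (∀ t ∈ Set.Icc 0 T, HasDerivWithinAt h 0 (Set.Icc 0 T) t) →
      ∀ t ∈ Set.Icc 0 T, h t = h 0 := fun h hh =>
    constant_of_has_deriv_right_zero (fun t ht => (hh t ht).continuousWithinAt)
      fun t ht => (hh t ⟨ht.1, ht.2.le⟩).mono_of_mem_nhdsWithin (Icc_mem_nhdsGE_of_mem ht)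
  have hq : ∀ i, ∀ t ∈ Set.Icc 0 T, HasDerivWithinAt (fun t => (γ t).2.2.1 i)
      (hat ((γ t).2.2.2 i) *ᵥ (γ t).2.2.1 i) (Set.Icc 0 T) t := fun i t ht =>
    hasDerivWithinAt_pi.1 (hγ t ht).snd.snd.fst i
  have hw : ∀ i, ∀ t ∈ Set.Icc 0 T, HasDerivWithinAt (fun t => (γ t).2.2.2 i)
      ((acceleration P u (γ t)).2 i) (Set.Icc 0 T) t := fun i t ht =>
    hasDerivWithinAt_pi.1 (hγ t ht).snd.snd.snd i
  have hunit : ∀ i, ∀ t ∈ Set.Icc 0 T, (γ t).2.2.1 i ⬝ᵥ (γ t).2.2.1 i = 1 := by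
    intro i t ht
    rw [hconst (fun t => (γ t).2.2.1 i ⬝ᵥ (γ t).2.2.1 i) (fun t ht => ?_) t ht, (h0 i).1]
    have h := hasDerivWithinAt_dotProduct (hq i t ht) (hq i t ht)
    rwa [dotProduct_comm _ (hat _ *ᵥ _), hat_dotProduct_self, add_zero] at h
  intro t ht i
  refine ⟨hunit i t ht, ?_⟩
  rw [hconst (fun t => (γ t).2.2.2 i ⬝ᵥ (γ t).2.2.1 i) (fun t ht => ?_) t ht, (h0 i).2]
  have h := hasDerivWithinAt_dotProduct (hw i t ht) (hq i t ht)
  have h1 : (acceleration P u (γ t)).2 i ⬝ᵥ (γ t).2.2.1 i = 0 := by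
    have h2 := inertia_snd_dotProduct P (γ t).2.2.1 (acceleration P u (γ t)) i
    rw [inertia_acceleration P u (isInvertible_inertia P fun i => hunit i t ht),
      force_snd_dotProduct] at h2
    exact (mul_eq_zero.1 h2.symm).resolve_left (P.Mq_self_pos i).ne'
  rwa [h1, dotProduct_comm _ (hat _ *ᵥ _), dotProduct_hat_self, zero_add] at h

end VectorField

/-! ### Positive definite quadratic forms -/

section QuadraticForm

variable {ι : Type*} [Fintype ι]

theorem posDef_lower_bound {Q : Matrix ι ι ℝ} (hQ : Q.PosDef) :
    ∃ c : ℝ, 0 < c ∧ ∀ y : ι → ℝ, c * ‖y‖ ^ 2 ≤ y ⬝ᵥ (Q *ᵥ y) := by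
  have hpos : ∀ y : ι → ℝ, y ≠ 0 → 0 < y ⬝ᵥ (Q *ᵥ y) := fun y hy => by
    simpa using hQ.dotProduct_mulVec_pos hy
  have hcont : Continuous fun y : ι → ℝ => y ⬝ᵥ (Q *ᵥ y) := by fun_prop
  rcases (Metric.sphere (0 : ι → ℝ) 1).eq_empty_or_nonempty with hemp | hne
  · refine ⟨1, one_pos, fun y => ?_⟩
    have hy : y = 0 := by
      by_contra hy
      have : (‖y‖⁻¹ • y) ∈ Metric.sphere (0 : ι → ℝ) 1 := by
        simp [norm_smul, norm_ne_zero_iff.2 hy]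
      rw [hemp] at this
      exact this
    simp [hy]
  · obtain ⟨y₀, hy₀, hmin⟩ := (isCompact_sphere (0 : ι → ℝ) 1).exists_isMinOn hne
      hcont.continuousOn
    have hy₀0 : y₀ ≠ 0 := by
      rintro rfl
      simp at hy₀
    refine ⟨_, hpos y₀ hy₀0, fun y => ?_⟩
    by_cases hy : y = 0
    · simp [hy]
    have hny : ‖y‖ ≠ 0 := norm_ne_zero_iff.2 hy
    have h1 : (‖y‖⁻¹ • y) ∈ Metric.sphere (0 : ι → ℝ) 1 := by
      simp [norm_smul, hny]
    have h2 := hmin h1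
    simp only [Set.mem_ofPred_eq, Matrix.mulVec_smul, dotProduct_smul, smul_dotProduct,
      smul_eq_mul] at h2
    have h3 := mul_le_mul_of_nonneg_right h2 (sq_nonneg ‖y‖)
    refine h3.trans (le_of_eq ?_)
    field_simp

end QuadraticForm

/-! ### Linearization at the equilibrium -/

section Linearization

variable {n : ℕ} (P : Params n) (s : Fin n → ℝ)

/-- The coordinates `[δx; Cᵀ ξ₁; …; Cᵀ ξₙ]` of a cart position and link directions. At the
equilibrium directions `sᵢ e₃`, `sᵢ e₃ × δqᵢ = ξᵢ` for `δqᵢ = ξᵢ × sᵢ e₃`. -/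
def posCoord (x : Fin 2 → ℝ) (q : Fin n → Fin 3 → ℝ) : LinIdx n → ℝ :=
  Sum.elim x fun ik => (Cᵀ *ᵥ (hat (s ik.1 • e3) *ᵥ q ik.1)) ik.2

/-- The horizontal parts of cart and angular velocities, or of the corresponding accelerations,
forces and moments. -/
def velCoord (a : Acc n) : LinIdx n → ℝ :=
  Sum.elim a.1 fun ik => (Cᵀ *ᵥ a.2 ik.1) ik.2

/-- The state `(𝐱, 𝐱̇)` of the linearized equation, as a linear function of `(x, ẋ, q, ω)`. -/
noncomputable def linCoord : State n →L[ℝ] (LinIdx n ⊕ LinIdx n → ℝ) :=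
  LinearMap.toContinuousLinearMap
    { toFun := fun z => Sum.elim (posCoord s z.1 z.2.2.1) (velCoord (z.2.1, z.2.2.2))
      map_add' := fun z z' => by
        ext ((_ | _) | (_ | _)) <;> simp [posCoord, velCoord, Matrix.mulVec_add]
      map_smul' := fun c z => by
        ext ((_ | _) | (_ | _)) <;> simp [posCoord, velCoord, Matrix.mulVec_smul] }

theorem linCoord_apply (z : State n) :
    linCoord s z = Sum.elim (posCoord s z.1 z.2.2.1) (velCoord (z.2.1, z.2.2.2)) := rfl

theorem linCoord_equilibrium : linCoord s (equilibrium s) = 0 := by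
  have h : ∀ i, Cᵀ *ᵥ (hat (s i • e3) *ᵥ (s i • e3)) = 0 := fun i => by
    rw [hat_mulVec, cross_self, Matrix.mulVec_zero]
  ext ((_ | _) | (_ | _)) <;> simp only [linCoord_apply, posCoord, velCoord, equilibrium, h,
    Sum.elim_inl, Sum.elim_inr, Pi.zero_apply, Matrix.mulVec_zero]

/-- The gains encoded in a feedback matrix for the linearized equation. -/
def gainsOfMatrix (K : Matrix (Fin 2) (LinIdx n ⊕ LinIdx n) ℝ) : Gains n where
  Kx := Matrix.of fun k l => K k (Sum.inl (Sum.inl l))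
  Kv := Matrix.of fun k l => K k (Sum.inr (Sum.inl l))
  Kq i := Matrix.of fun k l => K k (Sum.inl (Sum.inr (i, l)))
  Kw i := Matrix.of fun k l => K k (Sum.inr (Sum.inr (i, l)))

theorem feedback_gainsOfMatrix (K : Matrix (Fin 2) (LinIdx n ⊕ LinIdx n) ℝ) (z : State n) :
    feedback s (gainsOfMatrix K) z = -(K *ᵥ linCoord s z) := by
  obtain ⟨x, v, q, w⟩ := z
  ext k
  have h : (K *ᵥ linCoord s (x, v, q, w)) k
      = (∑ l, K k (Sum.inl (Sum.inl l)) * x l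
          + ∑ i, ∑ l, K k (Sum.inl (Sum.inr (i, l))) * (Cᵀ *ᵥ (hat (s i • e3) *ᵥ q i)) l)
        + (∑ l, K k (Sum.inr (Sum.inl l)) * v l
          + ∑ i, ∑ l, K k (Sum.inr (Sum.inr (i, l))) * (Cᵀ *ᵥ w i) l) := by
    rw [Matrix.mulVec, dotProduct, Fintype.sum_sum_type, Fintype.sum_sum_type,
      Fintype.sum_sum_type, Fintype.sum_prod_type, Fintype.sum_prod_type]
    rfl
  rw [Pi.neg_apply, h]
  have h' : feedback s (gainsOfMatrix K) (x, v, q, w) k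
      = -(∑ l, K k (Sum.inl (Sum.inl l)) * x l) - ∑ l, K k (Sum.inr (Sum.inl l)) * v l
        - ∑ i, (∑ l, K k (Sum.inl (Sum.inr (i, l))) * (Cᵀ *ᵥ (hat (s i • e3) *ᵥ q i)) l
          + ∑ l, K k (Sum.inr (Sum.inr (i, l))) * (Cᵀ *ᵥ w i) l) := by
    simp only [feedback, Pi.sub_apply, Pi.neg_apply, Finset.sum_apply, Pi.add_apply]
    rfl
  rw [h', Finset.sum_add_distrib]
  ring

theorem M0_mulVec (i : Fin n) (y : Fin 3 → ℝ) :
    P.M0 i *ᵥ y = (P.outerMass i * P.length i) • ![y 0, y 1] := by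
  rw [Params.M0, Matrix.smul_mulVec, C_transpose_mulVec]

theorem M0_transpose_mulVec (i : Fin n) (c : Fin 2 → ℝ) :
    (P.M0 i)ᵀ *ᵥ c = (P.outerMass i * P.length i) • ![c 0, c 1, 0] := by
  rw [Params.M0, Matrix.transpose_smul, Matrix.transpose_transpose, Matrix.smul_mulVec,
    C_mulVec]

theorem M0_mul_hat_e3_mul_C (i : Fin n) :
    P.M0 i * hat e3 * C = (P.outerMass i * P.length i) • !![0, -1; 1, 0] := by
  ext k l
  fin_cases k <;> fin_cases l <;>
    simp [Params.M0, C, hat, e3, Matrix.mul_apply, Fin.sum_univ_three]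

variable {s}

/-- The matrix `𝐌` is the inertia operator at the equilibrium configuration, in coordinates. -/
theorem linM_mulVec_velCoord (hs : ∀ i, s i = 1 ∨ s i = -1) (a : Acc n) :
    linM P s *ᵥ velCoord a = velCoord (inertia P (fun i => s i • e3) a) := by
  have hss : ∀ i, s i * s i = 1 := fun i => by rcases hs i with h | h <;> simp [h]
  rw [linM, Matrix.fromBlocks_mulVec]
  ext (k | ⟨i, k⟩)
  · have h1 : (linMxq P s *ᵥ (velCoord a ∘ Sum.inr)) k
        = -∑ j, (P.M0 j *ᵥ (hat (s j • e3) *ᵥ a.2 j)) k := by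
      rw [Matrix.mulVec, dotProduct, Fintype.sum_prod_type, ← Finset.sum_neg_distrib]
      refine Finset.sum_congr rfl fun j _ => ?_
      simp only [linMxq, Matrix.of_apply, velCoord, Function.comp_apply, Sum.elim_inr,
        M0_mul_hat_e3_mul_C, M0_mulVec, hat_smul, Matrix.smul_mulVec, hat_e3_mulVec,
        C_transpose_mulVec, Fin.sum_univ_two]
      fin_cases k <;> simp <;> ring
    simp only [Sum.elim_inl, Pi.add_apply, h1]
    simp only [Sum.elim_inl, velCoord, inertia_apply, Pi.sub_apply, Finset.sum_apply,
      Matrix.smul_mulVec, Matrix.one_mulVec, Pi.smul_apply, Function.comp_apply]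
    ring
  · have h1 : ((linMxq P s)ᵀ *ᵥ (velCoord a ∘ Sum.inl)) (i, k)
        = (Cᵀ *ᵥ (hat (s i • e3) *ᵥ ((P.M0 i)ᵀ *ᵥ a.1))) k := by
      have h : ((linMxq P s)ᵀ *ᵥ (velCoord a ∘ Sum.inl)) (i, k)
          = ∑ l, (-s i • (P.M0 i * hat e3 * C)) l k * a.1 l := rfl
      rw [h, M0_mul_hat_e3_mul_C, M0_transpose_mulVec, Fin.sum_univ_two, hat_smul,
        Matrix.smul_mulVec, hat_e3_mulVec, C_transpose_mulVec]
      fin_cases k <;> simp <;> ring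
    have h2 : (linMqq P s *ᵥ (velCoord a ∘ Sum.inr)) (i, k)
        = ∑ j, s i * s j * P.Mq i j * (Cᵀ *ᵥ a.2 j) k := by
      rw [Matrix.mulVec, dotProduct, Fintype.sum_prod_type]
      refine Finset.sum_congr rfl fun j _ => ?_
      simp only [linMqq, Matrix.of_apply, velCoord, Function.comp_apply, Sum.elim_inr,
        Fin.sum_univ_two]
      fin_cases k <;> simp
    have h3 : ∀ j, (Cᵀ *ᵥ (hat (s i • e3) *ᵥ (hat (s j • e3) *ᵥ a.2 j))) k
        = -(s i * s j * (Cᵀ *ᵥ a.2 j) k) := by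
      intro j
      simp only [hat_smul, Matrix.smul_mulVec, Matrix.mulVec_smul, hat_e3_mulVec,
        C_transpose_mulVec]
      fin_cases k <;> simp <;> ring
    simp only [Sum.elim_inr, Pi.add_apply, h1, h2]
    simp only [Sum.elim_inr, velCoord, inertia_apply, Matrix.mulVec_sub,
      Matrix.mulVec_add, Matrix.mulVec_smul, Matrix.mulVec_sum, Pi.sub_apply,
      Pi.add_apply, Finset.sum_apply, Pi.smul_apply, smul_eq_mul, h3]
    rw [← Finset.add_sum_erase _ _ (Finset.mem_univ i), hss, one_mul, ← add_assoc, sub_eq_add_neg,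
      ← Finset.sum_neg_distrib]
    congr 1
    exact Finset.sum_congr rfl fun j _ => by ring

theorem velCoord_appliedForce (hs : ∀ i, s i = 1 ∨ s i = -1) (u x : Fin 2 → ℝ)
    (q : Fin n → Fin 3 → ℝ) :
    velCoord (appliedForce P u q) = linB n *ᵥ u - linG P s *ᵥ posCoord s x q := by
  have hss : ∀ i, s i * s i = 1 := fun i => by rcases hs i with h | h <;> simp [h]
  rw [linB, linG, Matrix.fromRows_mulVec, Matrix.fromBlocks_mulVec]
  ext (k | ⟨i, k⟩)
  · simp [velCoord, appliedForce]
  · simp only [velCoord, appliedForce, posCoord, linGqq, Sum.elim_inr, Pi.sub_apply, Pi.add_apply,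
      Matrix.zero_mulVec, Pi.zero_apply, Matrix.mulVec_diagonal, Function.comp_apply,
      Matrix.mulVec_smul, Pi.smul_apply, hat_smul, Matrix.smul_mulVec,
      C_transpose_mulVec, hat_mulVec_eq, e3, smul_eq_mul]
    have h := hss i
    fin_cases k
    · simp
      linear_combination (-(P.outerMass i * P.g * P.length i * q i 1)) * h
    · simp
      linear_combination (-(P.outerMass i * P.g * P.length i * q i 0)) * h

theorem equilibrium_mem_phaseSpace (hs : ∀ i, s i = 1 ∨ s i = -1) :
    equilibrium s ∈ phaseSpace n := fun i => by
  rcases hs i with h | h <;> simp [equilibrium, h, e3, dotProduct, Fin.sum_univ_three]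

theorem isInvertible_inertia_equilibrium (hs : ∀ i, s i = 1 ∨ s i = -1) :
    (inertia P fun i => s i • e3).IsInvertible :=
  isInvertible_inertia P fun i => (equilibrium_mem_phaseSpace hs i).1

theorem isUnit_det_linM (hs : ∀ i, s i = 1 ∨ s i = -1) : IsUnit (linM P s).det := by
  have hs0 : ∀ i, s i ≠ 0 := fun i => by rcases hs i with h | h <;> simp [h]
  rw [← Matrix.isUnit_iff_isUnit_det, ← Matrix.mulVec_injective_iff_isUnit]
  refine (injective_iff_map_eq_zero (linM P s).mulVecLin).2 fun y hy => ?_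
  -- Lift `y` to accelerations without vertical components.
  set a : Acc n := (y ∘ Sum.inl, fun i => ![y (Sum.inr (i, 0)), y (Sum.inr (i, 1)), 0]) with ha
  have hya : velCoord a = y := by
    ext (k | ⟨i, k⟩)
    · rfl
    · simp only [velCoord, Sum.elim_inr, ha, C_transpose_mulVec]
      fin_cases k <;> simp
  rw [Matrix.mulVecLin_apply, ← hya, linM_mulVec_velCoord P hs] at hy
  have h0 : inertia P (fun i => s i • e3) a = 0 := by
    refine Prod.ext (funext fun k => congrFun hy (Sum.inl k)) (funext fun i => ?_)
    have h1 : ∀ k, (Cᵀ *ᵥ (inertia P (fun i => s i • e3) a).2 i) k = 0 := fun k =>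
      congrFun hy (Sum.inr (i, k))
    rw [C_transpose_mulVec] at h1
    have h3 : ∀ y : Fin 3 → ℝ, y ⬝ᵥ (s i • e3) = s i * y 2 := fun y => by
      simp [e3, dotProduct, Fin.sum_univ_three, mul_comm]
    have h2 : (inertia P (fun i => s i • e3) a).2 i ⬝ᵥ (s i • e3)
        = P.Mq i i * (a.2 i ⬝ᵥ (s i • e3)) := inertia_snd_dotProduct P (fun i => s i • e3) a i
    rw [h3, h3, show a.2 i 2 = 0 from rfl, mul_zero, mul_zero] at h2
    ext k
    fin_cases k
    · exact h1 0
    · exact h1 1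
    · exact (mul_eq_zero.1 h2).resolve_left (hs0 i)
  rw [← hya, (isInvertible_inertia_equilibrium P hs).injective (h0.trans (map_zero _).symm)]
  ext (_ | _) <;> simp [velCoord]

theorem centrifugal_smul (q w : Fin n → Fin 3 → ℝ) (t : ℝ) :
    centrifugal P q (t • w) = t ^ 2 • centrifugal P q w := by
  refine Prod.ext ?_ (funext fun i => ?_)
  · simp only [centrifugal, Pi.smul_apply, Prod.smul_fst, smul_dotProduct, dotProduct_smul,
      Finset.smul_sum, smul_smul, smul_eq_mul]
    exact Finset.sum_congr rfl fun j _ => by congr 1; ring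
  · simp only [centrifugal, Pi.smul_apply, Prod.smul_snd, smul_dotProduct, dotProduct_smul,
      Finset.smul_sum, smul_smul, smul_eq_mul]
    exact Finset.sum_congr rfl fun j _ => by congr 1; ring

theorem appliedForce_equilibrium_add (u : Fin 2 → ℝ) (κ : Fin n → Fin 3 → ℝ) (t : ℝ) :
    appliedForce P (t • u) ((fun i => s i • e3) + t • κ) = t • appliedForce P u κ := by
  refine Prod.ext rfl (funext fun i => ?_)
  have h : hat e3 *ᵥ e3 = 0 := by rw [hat_mulVec, cross_self]
  simp only [appliedForce, Prod.smul_snd, Pi.smul_apply, Pi.add_apply, hat_add, hat_smul,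
    Matrix.add_mulVec, Matrix.smul_mulVec, h, smul_zero, zero_add]
  exact smul_comm _ _ _

/-- State matrix of the first-order form of `𝐌 𝐱̈ + 𝐆 𝐱 = 𝐁 u`. -/
noncomputable def stateMatrix (s : Fin n → ℝ) :
    Matrix (LinIdx n ⊕ LinIdx n) (LinIdx n ⊕ LinIdx n) ℝ :=
  Matrix.fromBlocks 0 1 (-((linM P s)⁻¹ * linG P s)) 0

/-- Input matrix of the first-order form of `𝐌 𝐱̈ + 𝐆 𝐱 = 𝐁 u`. -/
noncomputable def inputMatrix (s : Fin n → ℝ) : Matrix (LinIdx n ⊕ LinIdx n) (Fin 2) ℝ :=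
  Matrix.fromRows 0 ((linM P s)⁻¹ * linB n)

theorem vectorField_equilibrium {u : State n → Fin 2 → ℝ} (hu : u (equilibrium s) = 0) :
    vectorField P u (equilibrium s) = 0 := by
  have h := centrifugal_smul P (fun i => s i • e3) 0 0
  have h' := appliedForce_equilibrium_add P (s := s) 0 0 0
  simp only [smul_zero, zero_smul, add_zero, ne_eq, OfNat.ofNat_ne_zero, not_false_eq_true,
    zero_pow] at h h'
  have h2 : acceleration P u (equilibrium s) = 0 := by
    rw [acceleration, hu]
    change (inertia P _).inverse (centrifugal P (fun i => s i • e3) 0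
      + appliedForce P 0 (fun i => s i • e3)) = 0
    rw [h, h', add_zero, map_zero]
  rw [vectorField, h2]
  refine Prod.ext rfl (Prod.ext rfl (Prod.ext (funext fun i => ?_) rfl))
  change hat 0 *ᵥ _ = 0
  rw [hat_mulVec, map_zero]
  rfl

/-- The linear coordinates intertwine the derivative of the closed-loop vector field at the
equilibrium with the linearized closed loop. All derivatives are read off along the line
`t ↦ e + t ζ`, on which the terms quadratic in the velocities are `O(t²)`. -/
theorem linCoord_fderiv (hs : ∀ i, s i = 1 ∨ s i = -1)
    (K : Matrix (Fin 2) (LinIdx n ⊕ LinIdx n) ℝ) {D : State n →L[ℝ] State n}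
    (hD : HasFDerivAt (vectorField P fun z => -(K *ᵥ linCoord s z)) D (equilibrium s))
    (ζ : State n) :
    linCoord s (D ζ) = (stateMatrix P s - inputMatrix P s * K) *ᵥ linCoord s ζ := by
  set u : State n → Fin 2 → ℝ := fun z => -(K *ᵥ linCoord s z) with hu
  obtain ⟨x, v, κ, w⟩ := ζ
  set ζ : State n := (x, v, κ, w) with hζ
  set ℓ : ℝ → State n := fun t => equilibrium s + t • ζ with hℓdef
  have hue : ∀ t, u (ℓ t) = t • u ζ := fun t => by
    simp only [hu, hℓdef, map_add, linCoord_equilibrium, map_smul, zero_add, Matrix.mulVec_smul,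
      smul_neg]
  have hℓ : HasDerivAt ℓ ζ 0 := by
    have h := ((hasDerivAt_id (0 : ℝ)).smul_const ζ).const_add (equilibrium s)
    rw [one_smul] at h
    exact h
  have hℓ0 : ℓ 0 = equilibrium s := by simp [hℓdef]
  have hφ : HasDerivAt (fun t => vectorField P u (ℓ t)) (D ζ) 0 :=
    hD.comp_hasDerivAt_of_eq 0 hℓ hℓ0.symm
  have hℓq : ∀ t, (ℓ t).2.2.1 = (fun i => s i • e3) + t • κ := fun t => rfl
  have hℓw : ∀ t, (ℓ t).2.2.2 = t • w := fun t => by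
    change (0 : Fin n → Fin 3 → ℝ) + t • w = t • w
    rw [zero_add]
  have hℓv : ∀ t, (ℓ t).2.1 = t • v := fun t => by
    change (0 : Fin 2 → ℝ) + t • v = t • v
    rw [zero_add]
  have hDx : (D ζ).1 = v := by
    have h : HasDerivAt (fun t => (vectorField P u (ℓ t)).1) (D ζ).1 0 := hφ.fst
    refine h.unique ?_
    simp only [vectorField, hℓv]
    simpa using (hasDerivAt_id (0 : ℝ)).smul_const v
  have hDq : ∀ i, (D ζ).2.2.1 i = hat (w i) *ᵥ (s i • e3) := by
    intro i
    refine (hasDerivAt_pi.1 hφ.snd.snd.fst i).unique ?_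
    have h := hasDerivAt_smul_add_sq_smul (a := hat (w i) *ᵥ (s i • e3))
      (R := fun _ => hat (w i) *ᵥ κ i) contDiffAt_const
    convert h using 2 with t
    simp only [vectorField, hℓq, hℓw, Pi.add_apply, Pi.smul_apply, hat_smul, Matrix.smul_mulVec,
      Matrix.mulVec_add, Matrix.mulVec_smul]
    module
  have hA : HasDerivAt (fun t => acceleration P u (ℓ t)) ((D ζ).2.1, (D ζ).2.2.2) 0 :=
    hφ.snd.fst.prodMk hφ.snd.snd.snd
  have hA0 : acceleration P u (ℓ 0) = 0 := by
    have h := vectorField_equilibrium P (s := s) (u := u) (by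
      simp only [hu, linCoord_equilibrium, Matrix.mulVec_zero, neg_zero])
    rw [← hℓ0] at h
    exact Prod.ext (congrArg (fun d => d.2.1) h) (congrArg (fun d => d.2.2.2) h)
  have hforce : HasDerivAt (fun t => inertia P (ℓ t).2.2.1 (acceleration P u (ℓ t)))
      (appliedForce P (u ζ) κ) 0 := by
    have hR : ContDiffAt ℝ 1 (fun t : ℝ => centrifugal P ((fun i => s i • e3) + t • κ) w) 0 := by
      refine ContDiffAt.prodMk (by simp only [Pi.add_apply, Pi.smul_apply]; fun_prop) ?_
      rw [contDiffAt_pi]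
      intro i
      simp only [Pi.add_apply, Pi.smul_apply]
      fun_prop
    refine (hasDerivAt_smul_add_sq_smul (a := appliedForce P (u ζ) κ) hR).congr_of_eventuallyEq ?_
    have hev : ∀ᶠ t in 𝓝 (0 : ℝ), (inertia P (ℓ t).2.2.1).IsInvertible := by
      have hc : ContinuousAt (fun t => (ℓ t).2.2.1) 0 := hℓ.continuousAt.snd.snd.fst
      refine hc.eventually ((isOpen_setOf_isInvertible_inertia P).mem_nhds ?_)
      change (inertia P (ℓ 0).2.2.1).IsInvertible
      rw [hℓ0]
      exact isInvertible_inertia_equilibrium P hs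
    filter_upwards [hev] with t ht
    rw [inertia_acceleration P u ht, hue, hℓq, hℓw, centrifugal_smul,
      appliedForce_equilibrium_add, add_comm]
  have hI : HasDerivAt (fun t => inertia P (ℓ t).2.2.1)
      (fderiv ℝ (inertia P) (ℓ 0).2.2.1 κ) 0 :=
    (((contDiff_inertia P).differentiable one_ne_zero _).hasFDerivAt).comp_hasDerivAt 0
      hℓ.snd.snd.fst
  have hlin : inertia P (fun i => s i • e3) ((D ζ).2.1, (D ζ).2.2.2)
      = appliedForce P (u ζ) κ := by
    have h := (hI.clm_apply hA).unique hforce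
    rw [hA0, map_zero, zero_add, hℓ0] at h
    exact h
  have hM := isUnit_det_linM P hs
  have hvel : velCoord ((D ζ).2.1, (D ζ).2.2.2)
      = (linM P s)⁻¹ *ᵥ (linB n *ᵥ u ζ - linG P s *ᵥ posCoord s x κ) := by
    rw [← velCoord_appliedForce P hs, ← hlin, ← linM_mulVec_velCoord P hs, Matrix.mulVec_mulVec,
      Matrix.nonsing_inv_mul _ hM, Matrix.one_mulVec]
  have hpos : posCoord s (D ζ).1 (D ζ).2.2.1 = velCoord (v, w) := by
    ext (k | ⟨i, k⟩)
    · simp [posCoord, velCoord, hDx]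
    · have hss : s i * s i = 1 := by rcases hs i with h | h <;> simp [h]
      simp only [posCoord, velCoord, Sum.elim_inr, hDq, hat_smul, Matrix.smul_mulVec,
        Matrix.mulVec_smul, hat_e3_mulVec, hat_mulVec_eq (w i), C_transpose_mulVec]
      fin_cases k
      · simp [e3]
        linear_combination (w i 0) * hss
      · simp [e3]
        linear_combination (w i 1) * hss
  rw [linCoord_apply s (D ζ), hpos, hvel, Matrix.sub_mulVec, ← Matrix.mulVec_mulVec, stateMatrix,
    inputMatrix, Matrix.fromBlocks_mulVec, Matrix.fromRows_mulVec,
    show K *ᵥ linCoord s ζ = -u ζ by simp [hu]]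
  ext (i | i)
  · simp [linCoord_apply, hζ]
  · simp only [Sum.elim_inr, Pi.sub_apply, linCoord_apply, hζ, Matrix.mulVec_sub,
      Matrix.mulVec_mulVec, Matrix.neg_mulVec, Matrix.zero_mulVec, Sum.elim_comp_inl,
      Matrix.mulVec_neg, Pi.add_apply, Pi.neg_apply, Pi.zero_apply]
    ring

theorem link_vertical_bound {q₀ q₁ q₂ w₀ w₁ w₂ σ ν : ℝ} (hσ : |σ| = 1)
    (hq : q₀ * q₀ + q₁ * q₁ + q₂ * q₂ = 1) (hwq : w₀ * q₀ + w₁ * q₁ + w₂ * q₂ = 0)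
    (h₀ : |q₀| < 1 / 2) (h₁ : |q₁| < 1 / 2) (h₂ : |q₂ - σ| < 1 / 2)
    (hq₀ : |q₀| ≤ ν) (hq₁ : |q₁| ≤ ν) (hw₀ : |w₀| ≤ ν) (hw₁ : |w₁| ≤ ν) :
    |q₂ - σ| ≤ 2 * ν ∧ |w₂| ≤ 2 * ν := by
  have hν : 0 ≤ ν := (abs_nonneg _).trans hq₀
  have hσ2 : σ * σ = 1 := by rw [← abs_mul_abs_self, hσ, one_mul]
  constructor
  · have h3 : |q₂ - σ| * |q₂ + σ| = |q₀| * |q₀| + |q₁| * |q₁| := by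
      rw [← abs_mul, abs_mul_abs_self, abs_mul_abs_self,
        show (q₂ - σ) * (q₂ + σ) = -(q₀ * q₀ + q₁ * q₁) by linear_combination hq - hσ2, abs_neg,
        abs_of_nonneg (add_nonneg (mul_self_nonneg _) (mul_self_nonneg _))]
    have h4 : 1 ≤ |q₂ + σ| := by
      have h5 : |2 * σ| ≤ |q₂ + σ| + |q₂ - σ| := by
        rw [show 2 * σ = (q₂ + σ) - (q₂ - σ) by ring]
        exact abs_sub _ _
      rw [abs_mul, hσ, abs_two] at h5
      linarith
    nlinarith [abs_nonneg (q₂ - σ), abs_nonneg q₀, abs_nonneg q₁]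
  · have h3 : |w₂| * |q₂| ≤ |w₀| * |q₀| + |w₁| * |q₁| := by
      rw [← abs_mul, ← abs_mul, ← abs_mul, show w₂ * q₂ = -(w₀ * q₀ + w₁ * q₁) by
        linear_combination hwq, abs_neg]
      exact abs_add_le _ _
    have h4 : 1 / 2 ≤ |q₂| := by
      have h5 : |σ| ≤ |q₂| + |q₂ - σ| := by
        rw [show |σ| = |q₂ - (q₂ - σ)| by rw [sub_sub_cancel]]
        exact abs_sub _ _
      linarith
    nlinarith [abs_nonneg w₂, abs_nonneg q₀, abs_nonneg q₁, abs_nonneg w₀, abs_nonneg w₁]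

/-- On the phase space near the equilibrium the linear coordinates control the whole state: the
vertical parts of `q i` and `ω i` are determined, to second order, by the horizontal ones. -/
theorem dist_equilibrium_le (hs : ∀ i, s i = 1 ∨ s i = -1) {z : State n}
    (hz : z ∈ phaseSpace n) (hd : dist z (equilibrium s) < 1 / 2) :
    dist z (equilibrium s) ≤ 2 * ‖linCoord s (z - equilibrium s)‖ := by
  rw [map_sub, linCoord_equilibrium, sub_zero]
  obtain ⟨x, v, q, w⟩ := z
  set ν := ‖linCoord s (x, v, q, w)‖ with hν
  have hν0 : 0 ≤ ν := norm_nonneg _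
  have hco : ∀ i, |linCoord s (x, v, q, w) i| ≤ ν := fun i => by
    rw [← Real.norm_eq_abs]
    exact norm_le_pi_norm _ i
  rw [dist_eq_norm] at hd ⊢
  have hq2 : ∀ i k, |q i k - (s i • e3) k| < 1 / 2 := fun i k => by
    have h1 := norm_le_pi_norm ((q - fun i => s i • e3) i) k
    have h2 := norm_le_pi_norm (q - fun i => s i • e3) i
    have h3 : ‖q - fun i => s i • e3‖ ≤ ‖(x, v, q, w) - equilibrium s‖ :=
      (norm_fst_le ((x, v, q, w) - equilibrium s).2.2).trans
        ((norm_snd_le _).trans (norm_snd_le _))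
    exact ((h1.trans h2).trans h3).trans_lt hd
  have hxν : ∀ k, |x k| ≤ ν := fun k => hco (Sum.inl (Sum.inl k))
  have hvν : ∀ k, |v k| ≤ ν := fun k => hco (Sum.inr (Sum.inl k))
  have hwν : ∀ i k, |(Cᵀ *ᵥ w i) k| ≤ ν := fun i k => hco (Sum.inr (Sum.inr (i, k)))
  have hqν : ∀ i k, |(Cᵀ *ᵥ (hat (s i • e3) *ᵥ q i)) k| ≤ ν := fun i k =>
    hco (Sum.inl (Sum.inr (i, k)))
  have hlink : ∀ i k, |q i k - (s i • e3) k| ≤ 2 * ν ∧ |w i k| ≤ 2 * ν := by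
    intro i
    obtain ⟨h1, h2⟩ := hz i
    have hw0 := hwν i 0
    have hw1 := hwν i 1
    have hq0 := hqν i 0
    have hq1 := hqν i 1
    have ha := hq2 i 0
    have hb := hq2 i 1
    have hc := hq2 i 2
    rw [C_transpose_mulVec] at hw0 hw1 hq0 hq1
    rw [hat_smul, Matrix.smul_mulVec, hat_e3_mulVec] at hq0 hq1
    simp only [dotProduct, Fin.sum_univ_three] at h1 h2
    have habs : |s i| = 1 := by rcases hs i with h | h <;> simp [h]
    simp [-one_div, abs_mul, habs, e3] at hw0 hw1 hq0 hq1 ha hb hc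
    obtain ⟨h3, h4⟩ := link_vertical_bound habs h1 h2 ha hb hc hq1 hq0 hw0 hw1
    intro k
    fin_cases k <;> simp [e3]
    · constructor <;> linarith
    · constructor <;> linarith
    · exact ⟨h3, h4⟩
  have h2ν : (0 : ℝ) ≤ 2 * ν := by positivity
  refine norm_prod_le_iff.2 ⟨?_, norm_prod_le_iff.2 ⟨?_, norm_prod_le_iff.2 ⟨?_, ?_⟩⟩⟩
  · refine (pi_norm_le_iff_of_nonneg h2ν).2 fun k => ?_
    have := hxν k
    simp [equilibrium]
    linarith
  · refine (pi_norm_le_iff_of_nonneg h2ν).2 fun k => ?_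
    have := hvν k
    simp [equilibrium]
    linarith
  · exact (pi_norm_le_iff_of_nonneg h2ν).2 fun i => (pi_norm_le_iff_of_nonneg h2ν).2 fun k =>
      (hlink i k).1
  · refine (pi_norm_le_iff_of_nonneg h2ν).2 fun i => (pi_norm_le_iff_of_nonneg h2ν).2 fun k => ?_
    simpa [equilibrium] using (hlink i k).2

end Linearization

end ChainPendulum

/-! ### Stabilization of the chain pendulum -/

theorem proposition4 {n : ℕ} (P : ChainPendulum.Params n)
    (s : Fin n → ℝ) (hs : ∀ i, s i = 1 ∨ s i = -1)
    (hctrl : ChainPendulum.IsControllable (ChainPendulum.linM P s) (ChainPendulum.linG P s)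
      (ChainPendulum.linB n)) :
    ∃ K : ChainPendulum.Gains n,
      ChainPendulum.IsLocallyAsymptoticallyStable (ChainPendulum.phaseSpace n)
        (ChainPendulum.ClosedLoop P s K) (ChainPendulum.equilibrium s) := by
  open ChainPendulum in
  obtain ⟨K, Q, μ, hμ, hQ, hQA⟩ := exists_gain_lyapunov (stateMatrix P s) (inputMatrix P s)
    fun N => hctrl.eq_bot_of_invariant (isUnit_det_linM P hs) N
  obtain ⟨c, hc, hQc⟩ := posDef_lower_bound hQ
  refine ⟨gainsOfMatrix K, ?_⟩
  set u : State n → Fin 2 → ℝ := fun z => -(K *ᵥ linCoord s z) with hu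
  have hinv : ∀ z ∈ phaseSpace n, (inertia P z.2.2.1).IsInvertible := fun z hz =>
    isInvertible_inertia P fun i => (hz i).1
  have hmem := equilibrium_mem_phaseSpace hs
  have huC : ContDiffAt ℝ 1 u (equilibrium s) :=
    (contDiffAt_mulVec K (linCoord s).contDiff.contDiffAt).neg
  have hf : ContDiffAt ℝ 1 (vectorField P u) (equilibrium s) :=
    contDiffAt_vectorField P huC (hinv _ hmem)
  have hfe : vectorField P u (equilibrium s) = 0 :=
    vectorField_equilibrium P (by simp only [hu, linCoord_equilibrium, Matrix.mulVec_zero, neg_zero])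
  have hD := (hf.differentiableAt one_ne_zero).hasFDerivAt
  let b := (Matrix.toLinearMap₂' ℝ Q : (_ → ℝ) →ₗ[ℝ] (_ → ℝ) →ₗ[ℝ] ℝ).toContinuousBilinearMap
  have hb : ∀ y y', b y y' = y ⬝ᵥ (Q *ᵥ y') := fun y y' => Matrix.toLinearMap₂'_apply' Q y y'
  have hQt : Qᵀ = Q := by
    have := hQ.isHermitian
    rwa [Matrix.IsHermitian, Matrix.conjTranspose_eq_transpose_of_trivial] at this
  have hbsymm : ∀ y y', b y y' = b y' y := fun y y' => by
    rw [hb, hb, Matrix.dotProduct_mulVec, ← Matrix.mulVec_transpose, hQt, dotProduct_comm]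
  set A := stateMatrix P s - inputMatrix P s * K with hA
  have hbA : ∀ y, 2 * b y (A *ᵥ y) = -μ * b y y := by
    intro y
    have h1 : b y (A *ᵥ y) = y ⬝ᵥ ((Aᵀ * Q) *ᵥ y) := by
      rw [hbsymm, hb, ← Matrix.mulVec_mulVec, Matrix.dotProduct_mulVec y, Matrix.vecMul_transpose]
    have h2 : b y (A *ᵥ y) = y ⬝ᵥ ((Q * A) *ᵥ y) := by
      rw [hb, Matrix.mulVec_mulVec]
    have h3 := congrArg (fun M => y ⬝ᵥ (M *ᵥ y)) hQA
    simp only [Matrix.add_mulVec, dotProduct_add, Matrix.smul_mulVec, dotProduct_smul,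
      smul_eq_mul] at h3
    rw [two_mul]
    nth_rewrite 1 [h2]
    rw [h1, h3, hb]
  obtain ⟨V, r, c', hV⟩ := exists_isStrictLyapunov (Φ := phaseSpace n) hD hfe (linCoord s)
    (LinearMap.toContinuousLinearMap A.mulVecLin)
    (fun ζ => linCoord_fderiv P hs K hD ζ) one_half_pos two_pos
    (fun z hz hd => dist_equilibrium_le hs hz hd) b hbsymm hc hμ
    (fun y => by rw [hb]; exact hQc y) hbA
  refine hV.isLocallyAsymptoticallyStable hf hfe hmem (fun z hz d => ?_)
    (mem_phaseSpace_of_solution P u)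
  rw [ClosedLoop, feedback_gainsOfMatrix]
  exact eulerLagrange_iff_eq_vectorField P u (hinv z hz) d
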